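/- **Setting.** Let $z_1,\dots,z_r\in\mathbb C$ be distinct points (so there are $s=r+1$ marked points $z_1,\dots,z_r,\infty$), let $A_1,\dots,A_r$ be complex $n\times n$ matrices and $A_\infty=-\sum_{i=1}^rA_i$. They define the Fuchsian system $$\frac{d}{dz}Y=\sum_{i=1}^{r}\frac{A_i}{z-z_i}\,Y .$$ Index the marked points by $b\in\{1,\dots,r,\infty\}$. For each $b$ let $p_b\ge2$ and let $w_{b,1},\dots,w_{b,p_b}\in\mathbb C$ satisfy $\prod_{\ell=1}^{p_b}(A_b-w_{b,\ell})=0$. Suppose that the system is in normal form, $w_{i,1}=0$ for $i=1,\dots,r$, and put $\lambda_\star=\sum_b w_{b,1}$ (so $\lambda_\star=w_{\infty,1}$). Assume $\lambda_\star\ne0$. Put $E_{b,k}=\prod_{\ell=1}^k(A_b-w_{b,\ell})\,\mathbb C^n$ and $N_{b,1}=\dim E_{b,1}$. *Modules.* The star quiver has a central node $\star$ and nodes $(b,\ell)$, $1\le\ell\le p_b-1$, with arrows $(b,1)\to\star$ and $(b,\ell+1)\to(b,\ell)$. A module of its deformed preprojective algebra $\Pi^\lambda$ consists of complex vector spaces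 $X_\sigma$ and linear maps $X_v,X_{v^*}$ in both directions along every arrow $v$ such that $\sum_{t(v)=\sigma}X_vX_{v^*}-\sum_{s(v)=\sigma}X_{v^*}X_v+\lambda_\sigma=0$ at every node $\sigma$. Here $\lambda_\star$ is as above and $\lambda_{b,\ell}=w_{b,\ell+1}-w_{b,\ell}$. Write $X_{b,\ell},X^*_{b,\ell}$ for the two maps along the arrow that starts at $(b,\ell)$. Such a module *describes* the Fuchsian system if all $X_{b,\ell}$ are injective, all $X^*_{b,\ell}$ are surjective and, for some identification $X_\star\cong\mathbb C^n$, $A_b=X_{b,1}X^*_{b,1}+w_{b,1}$ for all $b$. *Reflection at $\star$.* Let $X_\oplus=\bigoplus_bX_{(b,1)}$ with inclusions $\mu_b$ and projections $\pi_b$, $\mu=\sum_b\mu_bX^*_{b,1}$, $\pi=-\lambda_\star^{-1}\sum_bX_{b,1}\pi_b$. The reflection functor at $\star$ sends $X$ to $X'$ with $X'_\star=\operatorname{Im}(1-\mu\pi)$, $X'_{b,1}=\lambda_\star(1-\mu\pi)\mu_b$, $X'^*_{b,1}=\pi_b|_{X'_\star}$, and everything else unchanged. The reflected couplings $\lambda'$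 are $\lambda'_\star=-\lambda_\star$, $\lambda'_{b,1}=\lambda_{b,1}+\lambda_\star$, $\lambda'_{b,\ell}=\lambda_{b,\ell}$ for $\ell\ge2$. *Middle convolution.* Let $G_i$ be the $rn\times rn$ matrix with $n\times n$ blocks $(G_i)_{jk}=\delta_{ij}(A_k+\delta_{ik}\lambda_\star)$, and let $V=\bigoplus_{i=1}^r\ker A_i+\ker\bigl(\sum_iG_i\bigr)\subset(\mathbb C^n)^r$. A middle convolution of the system consists of an $n'\times rn$ matrix $P=[P_1\,\cdots\,P_r]$ of the projection $(\mathbb C^n)^r\to(\mathbb C^n)^r/V$ (i.e. $P$ is surjective with kernel $V$) and $n'\times n'$ matrices $A'_i$ with $A'_iP=PG_i$ for $i=1,\dots,r$. Put $A'_\infty=-\sum_iA'_i$. *Contours.* A twisted cycle on an open set $D\subset\mathbb C\setminus\{z_1,\dots,z_r\}$ is a closed piecewise $C^1$ contour $\gamma$ in $\mathbb C\setminus(D\cup\{z_1,\dots,z_r\})$ with a branch along $\gamma$ of a (multivalued) solution $Y(s)$ of the given system and, for $z\in D$, a branch along $\gamma$ of $\log(z-s)$, jointly continuous in $z$ and the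 contour parameter, such that for every $z\in D$ the continuation of $Y(s)(z-s)^{\lambda_\star}$ along $\gamma$ returns to its initial value. **Claim.** 1. The spaces $X_\star=\mathbb C^n$, $X_{(b,\ell)}=E_{b,\ell}$, with $X_{b,\ell}$ the inclusion $E_{b,\ell}\subset E_{b,\ell-1}$ and $X^*_{b,\ell}=(A_b-w_{b,\ell})|_{E_{b,\ell-1}}$ (where $E_{b,0}=\mathbb C^n$), form a $\Pi^{\lambda}$-module that describes the system. A middle convolution of the system exists. 2. Every middle convolution has order $n'=\sum_bN_{b,1}-n$. 3. The Fuchsian system with residues $A'_1,\dots,A'_r$ produced by middle convolution is the one obtained by the reflection functor at $\star$: for every $\Pi^\lambda$-module $X$ that describes the original system, the reflected $X'$ is a $\Pi^{\lambda'}$-module, and there is one isomorphism $\mathbb C^{n'}\cong X'_\star$ that carries $A'_i$ to $X'_{i,1}X'^*_{i,1}$ for all $i=1,\dots,r$ and $A'_\infty$ to $X'_{\infty,1}X'^*_{\infty,1}-\lambda_\star$. 4. For every twisted cycle on $D$, $$Y'(z)=\sum_{i=1}^{r}\int_\gamma\frac{P_i\,Y(s)}{s-z_i}\,(z-s)^{\lambda_\star}\,ds\qquad(z\in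 D)$$ is a solution of the dual system $\frac{d}{dz}Y'=\sum_{i=1}^r\frac{A'_i}{z-z_i}Y'$. 5. Pochhammer contours are twisted cycles for every solution $Y$. Let $\zeta_0\in\mathbb C\setminus\{z_1,\dots,z_r\}$. Let $\alpha,\beta$ be closed piecewise $C^1$ loops in $\mathbb C\setminus\{z_1,\dots,z_r,\zeta_0\}$ with the same base point, such that $\log(\zeta_0-s)$ is single-valued along $\alpha$ and $\beta$ lies in an open disc containing none of the $z_i$. Then for every $v\in\mathbb C^n$ the contour $\gamma=\alpha\beta\alpha^{-1}\beta^{-1}$, with suitable branches of $Y$, with value $v$ at the start of $\gamma$, and of $\log(z-s)$, is a twisted cycle on some disc around $\zeta_0$. -/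

import Mathlib

open scoped Matrix Topology

noncomputable section

namespace Fuchs

/-! ### Representations of the doubled star quiver -/

/-- A representation of the double of the star quiver whose set of branches is `B`, the branch `b`
having the `m b + 1` nodes `(b, 0), …, (b, m b)`.  All arrows of the star quiver point towards the
central node: `inn b : (b, 0) → ⋆` and `arr b k : (b, k + 1) → (b, k)`; the maps `innStar`,
`arrStar` represent the opposite arrows.  (The node `(b, k)` is often written `•_{b, k+1}`.) -/
structure StarRep (B : Type) (m : B → ℕ) where
  center : Type
  node : (b : B) → Fin (m b + 1) → Type
  [centerGroup : AddCommGroup center]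
  [centerModule : Module ℂ center]
  [nodeGroup : ∀ b k, AddCommGroup (node b k)]
  [nodeModule : ∀ b k, Module ℂ (node b k)]
  inn : ∀ b, node b 0 →ₗ[ℂ] center
  innStar : ∀ b, center →ₗ[ℂ] node b 0
  arr : ∀ b (k : Fin (m b)), node b k.succ →ₗ[ℂ] node b k.castSucc
  arrStar : ∀ b (k : Fin (m b)), node b k.castSucc →ₗ[ℂ] node b k.succ

attribute [instance] StarRep.centerGroup StarRep.centerModule StarRep.nodeGroup StarRep.nodeModule

/-- A family of couplings `λ_σ`, one for every node `σ` of the star quiver. -/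
structure Couplings (B : Type) (m : B → ℕ) where
  center : ℂ
  node : ∀ b, Fin (m b + 1) → ℂ

/-- The reflection `λ_τ ↦ λ_τ - ⟨α_τ, α_⋆⟩ λ_⋆` at the central node, where `⟨ , ⟩` is the Cartan
form of the star graph: `⟨α_⋆, α_⋆⟩ = 2`, and `⟨α_τ, α_⋆⟩` is `-1` if `τ = (b, 0)` and `0` for the
other nodes. -/
def Couplings.reflect {B : Type} {m : B → ℕ} (lam : Couplings B m) : Couplings B m where
  center := -lam.center
  node := fun b k => if k = 0 then lam.node b k + lam.center else lam.node b k

namespace StarRep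

variable {B : Type} {m : B → ℕ}

/-- The sum of `X_v X_{v^*}` over the arrows `v` of the star quiver that end at `(b, k)`. -/
def incoming (X : StarRep B m) (b : B) (k : Fin (m b + 1)) : X.node b k →ₗ[ℂ] X.node b k :=
  Fin.lastCases (motive := fun k => X.node b k →ₗ[ℂ] X.node b k)
    0 (fun k => X.arr b k ∘ₗ X.arrStar b k) k

/-- The sum of `X_{v^*} X_v` over the arrows `v` of the star quiver that start at `(b, k)`. -/
def outgoing (X : StarRep B m) (b : B) (k : Fin (m b + 1)) : X.node b k →ₗ[ℂ] X.node b k :=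
  Fin.cases (motive := fun k => X.node b k →ₗ[ℂ] X.node b k)
    (X.innStar b ∘ₗ X.inn b) (fun k => X.arrStar b k ∘ₗ X.arr b k) k

/-- `X` is a module of the deformed preprojective algebra `Π^λ` of the star quiver:
`∑_{t(v) = σ} X_v X_{v^*} - ∑_{s(v) = σ} X_{v^*} X_v + λ_σ = 0` at every node `σ`. -/
def IsModule [Fintype B] (X : StarRep B m) (lam : Couplings B m) : Prop :=
  (∑ b, X.inn b ∘ₗ X.innStar b) + lam.center • LinearMap.id = 0 ∧
  ∀ b k, X.incoming b k - X.outgoing b k + lam.node b k • LinearMap.id = 0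

/-- The residue at the marked point `b` of the Fuchsian system of `X`, for the first exponents
`e`: `X_{b,1} X^*_{b,1} + e_b`. -/
def residue (X : StarRep B m) (e : B → ℂ) (b : B) : X.center →ₗ[ℂ] X.center :=
  X.inn b ∘ₗ X.innStar b + e b • LinearMap.id

/-- `μ : X_⋆ → X_⊕ = ⨁_b X_{(b,0)}`. -/
def mu (X : StarRep B m) : X.center →ₗ[ℂ] (∀ b, X.node b 0) :=
  LinearMap.pi X.innStar

/-- `π = -(1/λ_⋆) ∑_b X_{b,1} π_b : X_⊕ → X_⋆`. -/
def proj [Fintype B] (X : StarRep B m) (lam : ℂ) : (∀ b, X.node b 0) →ₗ[ℂ] X.center :=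
  -(1 / lam) • ∑ b, X.inn b ∘ₗ LinearMap.proj b

/-- `1 - μπ` on `X_⊕`. -/
def oneSub [Fintype B] (X : StarRep B m) (lam : ℂ) :
    (∀ b, X.node b 0) →ₗ[ℂ] (∀ b, X.node b 0) :=
  LinearMap.id - X.mu ∘ₗ X.proj lam

/-- The reflection functor at the central node (on objects), for the central coupling `lam`:
`X'_⋆ = Im(1 - μπ)`, `X'_{b,1} = λ_⋆ (1 - μπ) μ_b`, `X'^*_{b,1} = π_b|_{X'_⋆}`, everything else
unchanged. -/
def reflect [Fintype B] [DecidableEq B] (X : StarRep B m) (lam : ℂ) : StarRep B m where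
  center := LinearMap.range (X.oneSub lam)
  node := X.node
  inn := fun b => lam • ((X.oneSub lam).rangeRestrict ∘ₗ
    LinearMap.single ℂ (fun b => X.node b 0) b)
  innStar := fun b => LinearMap.proj b ∘ₗ (LinearMap.range (X.oneSub lam)).subtype
  arr := X.arr
  arrStar := X.arrStar

end StarRep

/-! ### Fuchsian systems with finite poles `z_i`, `i : Fin r`, and a pole at infinity

The marked points are indexed by `Option (Fin r)`, where `none` stands for the point at infinity. -/

/-- All the residue matrices of the system `dY/dz = ∑_i A_i/(z - z_i) Y`; the one at infinity
is `A_∞ = -∑_i A_i`. -/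
def resMat {n r : ℕ} (A : Fin r → Matrix (Fin n) (Fin n) ℂ) :
    Option (Fin r) → Matrix (Fin n) (Fin n) ℂ
  | none => -∑ i, A i
  | some i => A i

/-- `F` satisfies `dF/dz = ∑_i A_i/(z - z_i) F` at the point `x`. -/
def SolvesAt {n r : ℕ} (z : Fin r → ℂ) (A : Fin r → Matrix (Fin n) (Fin n) ℂ)
    (F : ℂ → Fin n → ℂ) (x : ℂ) : Prop :=
  HasDerivAt F (∑ i, (x - z i)⁻¹ • (A i *ᵥ F x)) x

/-- The subspace `E_k = (T - w_0) ⋯ (T - w_{k-1}) ℂⁿ`. -/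
def filt {n q : ℕ} (T : Matrix (Fin n) (Fin n) ℂ) (w : Fin q → ℂ) (k : ℕ) :
    Submodule ℂ (Fin n → ℂ) :=
  LinearMap.range (Matrix.mulVecLin (Polynomial.aeval T
    (∏ l ∈ Finset.univ.filter (fun l : Fin q => l.val < k),
      (Polynomial.X - Polynomial.C (w l)))))

theorem aeval_prod_succ {n q : ℕ} (T : Matrix (Fin n) (Fin n) ℂ) (w : Fin q → ℂ) (k : Fin q) :
    Polynomial.aeval T (∏ l ∈ Finset.univ.filter (fun l : Fin q => l.val < k.val + 1),
      (Polynomial.X - Polynomial.C (w l))) =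
    (T - w k • 1) * Polynomial.aeval T (∏ l ∈ Finset.univ.filter (fun l : Fin q => l.val < k.val),
      (Polynomial.X - Polynomial.C (w l))) := by
  have h : Finset.univ.filter (fun l : Fin q => l.val < k.val + 1) =
      insert k (Finset.univ.filter (fun l : Fin q => l.val < k.val)) := by
    ext l
    simp only [Finset.mem_filter, Finset.mem_univ, true_and, Finset.mem_insert, Fin.ext_iff]
    omega
  rw [h, Finset.prod_insert (by simp), map_mul]
  simp [Algebra.algebraMap_eq_smul_one]

theorem filt_succ_le {n q : ℕ} (T : Matrix (Fin n) (Fin n) ℂ) (w : Fin q → ℂ) (k : Fin q) :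
    filt T w (k.val + 1) ≤ filt T w k.val := by
  rintro _ ⟨v, rfl⟩
  refine ⟨(T - w k • 1) *ᵥ v, ?_⟩
  rw [Matrix.mulVecLin_apply, Matrix.mulVecLin_apply, Matrix.mulVec_mulVec, aeval_prod_succ]
  congr 1
  have hT : T - w k • 1 = Polynomial.aeval T (Polynomial.X - Polynomial.C (w k)) := by
    simp [Algebra.algebraMap_eq_smul_one]
  rw [hT, ← map_mul, ← map_mul, mul_comm]

theorem mulVec_mem_filt {n q : ℕ} (T : Matrix (Fin n) (Fin n) ℂ) (w : Fin q → ℂ) (k : Fin q)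
    (v : Fin n → ℂ) (hv : v ∈ filt T w k.val) :
    (T - w k • 1).mulVecLin v ∈ filt T w (k.val + 1) := by
  obtain ⟨u, rfl⟩ := hv
  refine ⟨u, ?_⟩
  rw [Matrix.mulVecLin_apply, Matrix.mulVecLin_apply, Matrix.mulVecLin_apply,
    Matrix.mulVec_mulVec, aeval_prod_succ]

theorem mulVec_mem_filt_one {n q : ℕ} (T : Matrix (Fin n) (Fin n) ℂ) (w : Fin (q + 1) → ℂ)
    (v : Fin n → ℂ) : (T - w 0 • 1).mulVecLin v ∈ filt T w 1 := by
  refine mulVec_mem_filt T w 0 v ⟨v, ?_⟩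
  simp

/-- The couplings attached to exponents `w b 0, …, w b (m b + 1)` at each marked point `b`:
`λ_⋆ = ∑_b w_{b,0}` and `λ_{(b,k)} = w_{b,k+1} - w_{b,k}`. -/
def couplingsOf {B : Type} [Fintype B] {m : B → ℕ} (w : ∀ b, Fin (m b + 2) → ℂ) :
    Couplings B m where
  center := ∑ b, w b 0
  node := fun b k => w b k.succ - w b k.castSucc

/-- The representation attached to a Fuchsian system: the spaces are `ℂⁿ` at the central node and
`E_{b,k+1} = (A_b - w_{b,0}) ⋯ (A_b - w_{b,k}) ℂⁿ` at the node `(b, k)`; the arrows of the star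
quiver are the inclusions, the opposite arrows are the restrictions of `A_b - w_{b,k}`. -/
def definingGauge {n r : ℕ} {m : Option (Fin r) → ℕ} (A : Fin r → Matrix (Fin n) (Fin n) ℂ)
    (w : ∀ b, Fin (m b + 2) → ℂ) : StarRep (Option (Fin r)) m where
  center := Fin n → ℂ
  node := fun b k => filt (resMat A b) (w b) (k.val + 1)
  inn := fun b => (filt (resMat A b) (w b) 1).subtype
  innStar := fun b => LinearMap.codRestrict (filt (resMat A b) (w b) 1)
    (resMat A b - w b 0 • 1).mulVecLin (mulVec_mem_filt_one _ _)
  arr := fun b k => Submodule.inclusion (filt_succ_le (resMat A b) (w b) k.succ.castSucc)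
  arrStar := fun b k => LinearMap.restrict
    (resMat A b - w b k.succ.castSucc • 1).mulVecLin
    (mulVec_mem_filt (resMat A b) (w b) k.succ.castSucc)

/-- `X` is a `Π^λ`-module (with the couplings given by the exponents `w`) that describes the
Fuchsian system with residues `A`: all `X_{b,k}` are injective, all `X^*_{b,k}` are surjective and,
after identifying `X_⋆` with `ℂⁿ`, `A_b = X_{b,1} X^*_{b,1} + w_{b,0}` at every marked point. -/
structure Describes {n r : ℕ} {m : Option (Fin r) → ℕ} (X : StarRep (Option (Fin r)) m)
    (A : Fin r → Matrix (Fin n) (Fin n) ℂ) (w : ∀ b, Fin (m b + 2) → ℂ) : Prop where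
  isModule : X.IsModule (couplingsOf w)
  inn_injective : ∀ b, Function.Injective (X.inn b)
  innStar_surjective : ∀ b, Function.Surjective (X.innStar b)
  arr_injective : ∀ b k, Function.Injective (X.arr b k)
  arrStar_surjective : ∀ b k, Function.Surjective (X.arrStar b k)
  residue_eq : ∃ e : (Fin n → ℂ) ≃ₗ[ℂ] X.center,
    ∀ b v, e (resMat A b *ᵥ v) = X.residue (fun b => w b 0) b (e v)

/-- The first exponents of a system in normal form: `0` at the finite points, `lam` at infinity. -/
def normExp {r : ℕ} (lam : ℂ) : Option (Fin r) → ℂ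
  | none => lam
  | some _ => 0

/-! ### Middle convolution -/

/-- The matrix `G_i`, of size `rn`, whose `n × n` blocks are
`(G_i)_{jk} = δ_{ij} (A_k + δ_{ik} λ)`. -/
def convMat {n r : ℕ} (A : Fin r → Matrix (Fin n) (Fin n) ℂ) (lam : ℂ) (i : Fin r) :
    Matrix (Fin r × Fin n) (Fin r × Fin n) ℂ :=
  Matrix.of fun x y =>
    if x.1 = i then
      (A y.1 + (if y.1 = i then lam else 0) • (1 : Matrix (Fin n) (Fin n) ℂ)) x.2 y.2
    else 0

/-- The subspace `V = (ker A_1 ⊕ ⋯ ⊕ ker A_r) + ker (∑_i G_i)` of `(ℂⁿ)^r`. -/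
def convKer {n r : ℕ} (A : Fin r → Matrix (Fin n) (Fin n) ℂ) (lam : ℂ) :
    Submodule ℂ (Fin r × Fin n → ℂ) :=
  (⨅ i, LinearMap.ker ((A i).mulVecLin ∘ₗ
      LinearMap.funLeft ℂ ℂ (fun k : Fin n => ((i, k) : Fin r × Fin n)))) ⊔
    LinearMap.ker (∑ i, convMat A lam i).mulVecLin

/-- `A'` is the tuple of residue matrices of the middle convolution of `A` with parameter `lam`,
computed with the matrix `P` of the projection `(ℂⁿ)^r → (ℂⁿ)^r / V` in some basis of the
quotient. -/
structure IsMiddleConvolution {n r n' : ℕ} (A : Fin r → Matrix (Fin n) (Fin n) ℂ) (lam : ℂ)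
    (P : Matrix (Fin n') (Fin r × Fin n) ℂ) (A' : Fin r → Matrix (Fin n') (Fin n') ℂ) : Prop where
  surjective : Function.Surjective P.mulVecLin
  ker_eq : LinearMap.ker P.mulVecLin = convKer A lam
  intertwines : ∀ i, A' i * P = P * convMat A lam i

/-! ### Contours and Riemann–Liouville integrals -/

/-- A piecewise continuously differentiable path parametrized by `[0, 1]`. -/
def PiecewiseC1 (γ : ℝ → ℂ) : Prop :=
  ∃ (N : ℕ) (t : ℕ → ℝ), Monotone t ∧ t 0 = 0 ∧ t N = 1 ∧
    ∀ k < N, ContDiffOn ℝ 1 γ (Set.Icc (t k) (t (k + 1)))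

/-- `y` is a branch along `γ` of a (multivalued) solution of `dY/dz = ∑_i A_i/(z - z_i) Y`: near
every parameter `t` it is the composite of `γ` with a holomorphic solution near `γ t`. -/
def IsSolutionAlong {n r : ℕ} (z : Fin r → ℂ) (A : Fin r → Matrix (Fin n) (Fin n) ℂ)
    (γ : ℝ → ℂ) (y : ℝ → Fin n → ℂ) : Prop :=
  ∀ t ∈ Set.Icc (0 : ℝ) 1, ∃ F : ℂ → Fin n → ℂ,
    (∀ᶠ x in 𝓝 (γ t), SolvesAt z A F x) ∧
    ∀ᶠ u in 𝓝[Set.Icc (0 : ℝ) 1] t, y u = F (γ u)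

/-- `γ` is a closed contour in `ℂ ∖ {z_i}`, `y` is a branch along `γ` of a solution `Y` of the
Fuchsian system and, for `ζ` in the open set `D`, `L ζ` is a branch of `log (ζ - s)` along `γ`,
continuous in `ζ` (so `γ` does not meet `D`), such that `Y(s) (ζ - s)^lam` returns to its initial
value when it is continued along `γ`. -/
structure IsTwistedCycle {n r : ℕ} (z : Fin r → ℂ) (A : Fin r → Matrix (Fin n) (Fin n) ℂ)
    (lam : ℂ) (D : Set ℂ) (γ : ℝ → ℂ) (y : ℝ → Fin n → ℂ) (L : ℂ → ℝ → ℂ) : Prop where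
  isOpen : IsOpen D
  not_mem : ∀ i, z i ∉ D
  piecewiseC1 : PiecewiseC1 γ
  closed : γ 0 = γ 1
  avoids : ∀ t ∈ Set.Icc (0 : ℝ) 1, ∀ i, γ t ≠ z i
  solution : IsSolutionAlong z A γ y
  log_continuous : ContinuousOn (fun q : ℂ × ℝ => L q.1 q.2) (D ×ˢ Set.Icc (0 : ℝ) 1)
  exp_log : ∀ ζ ∈ D, ∀ t ∈ Set.Icc (0 : ℝ) 1, Complex.exp (L ζ t) = ζ - γ t
  returns : ∀ ζ ∈ D,
    Complex.exp (lam * L ζ 1) • y 1 = Complex.exp (lam * L ζ 0) • y 0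

/-- `Y'(ζ) = ∑_i ∫_γ P_i Y(s) / (s - z_i) (ζ - s)^lam ds`, where `P_i` is the `i`-th block of `n`
columns of `P`. -/
def riemannLiouville {n r n' : ℕ} (z : Fin r → ℂ) (P : Matrix (Fin n') (Fin r × Fin n) ℂ)
    (lam : ℂ) (γ : ℝ → ℂ) (y : ℝ → Fin n → ℂ) (L : ℂ → ℝ → ℂ) (ζ : ℂ) : Fin n' → ℂ :=
  ∑ i, ∫ t in (0 : ℝ)..1,
    ((γ t - z i)⁻¹ * Complex.exp (lam * L ζ t) * deriv γ t) •
      (P.submatrix id (fun k : Fin n => (i, k)) *ᵥ y t)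

/-- The commutator `α β α⁻¹ β⁻¹` of two loops parametrized by `[0, 1]`. -/
def pochhammer (α β : ℝ → ℂ) (t : ℝ) : ℂ :=
  if t ≤ 1 / 4 then α (4 * t)
  else if t ≤ 1 / 2 then β (4 * t - 1)
  else if t ≤ 3 / 4 then α (3 - 4 * t)
  else β (4 - 4 * t)

end Fuchs

end

/-!
The first three claims are linear algebra. For a module `X` of the deformed preprojective algebra,
the relation at the central node says `π μ = 1`, so `1 - μπ` is a projection of `X_⊕` with kernel
the image of `μ`. If `X` describes the system, the map
`(v_i)_i ↦ (1 - μπ) ∑_i μ_i X^*_{i,1} v_i` from `(ℂⁿ)^r` to `X'_⋆` (`convToReflect`) is surjective,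
because `1 - μπ` kills the image of `μ` and so the summand at infinity is redundant; its kernel is
`V`, because `X^*_{i,1} v_i = X^*_{i,1} u` and `X^*_{∞,1} u = 0` say that `v` is the sum of a family
in `⨁ ker A_i` and a constant family in `ker ∑ G_i`; and it carries `G_i` to `X'_{i,1} X'^*_{i,1}`.
This identifies the middle convolution with the system of the reflected module
(`IsMiddleConvolution.exists_equiv_reflect`); its order is read off from the rank of `1 - μπ` for
the module made of the spaces `E_{b,k}` (`IsMiddleConvolution.order_add`).

For the integrals, put `W_k(ζ) = ∫_γ Y(s) (ζ - s)^λ / (s - z_k) ds`. Since `Y(s) (ζ - s)^λ` returns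
to its initial value along `γ`, its total derivative integrates to zero, which says
`∑_j A_j W_j = λ ∫_γ Y(s) (ζ - s)^{λ-1} ds`. Together with
`(ζ - z_k) / ((s - z_k) (ζ - s)) = 1 / (s - z_k) + 1 / (ζ - s)` this gives
`(ζ - z_k) W_k' = ∑_j A_j W_j + λ W_k`, so that the vector `(W_k)_k` satisfies the system with
residues `G_k` (`IsTwistedCycle.hasDerivAt_rlVector`), and its image under `P` the system with
residues `A'_k`.

For Pochhammer contours, a branch of `Y` is continued along `α` (`exists_isSolutionOn`), and
extends to a disc containing `β`, by the existence of holomorphic solutions of linear equations in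
discs (`exists_hasDerivAt_clm_apply`). So `β` does not change `Y` and `α` does not change `(ζ - s)^λ`, and
the commutator changes neither.
-/

noncomputable section

namespace Fuchs

/-! ### The module of a Fuchsian system -/

namespace StarRep

variable {B : Type} {m : B → ℕ} (X : StarRep B m)

theorem incoming_last (b : B) : X.incoming b (Fin.last (m b)) = 0 := by
  simp [incoming]

theorem incoming_castSucc (b : B) (k : Fin (m b)) :
    X.incoming b k.castSucc = X.arr b k ∘ₗ X.arrStar b k := by
  simp [incoming]

theorem outgoing_zero (b : B) : X.outgoing b 0 = X.innStar b ∘ₗ X.inn b := by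
  simp [outgoing]

theorem outgoing_succ (b : B) (k : Fin (m b)) :
    X.outgoing b k.succ = X.arrStar b k ∘ₗ X.arr b k := by
  simp [outgoing]

end StarRep

theorem sum_resMat {n r : ℕ} (A : Fin r → Matrix (Fin n) (Fin n) ℂ) : ∑ b, resMat A b = 0 := by
  simp [Fintype.sum_option, resMat]

section DefiningGauge

variable {n r : ℕ} {m : Option (Fin r) → ℕ} (A : Fin r → Matrix (Fin n) (Fin n) ℂ)
  (w : ∀ b, Fin (m b + 2) → ℂ)

/-- The inclusion of the space `E_{b,k+1}` at the node `(b, k)` into `ℂⁿ`. -/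
def gaugeIncl (b : Option (Fin r)) (k : Fin (m b + 1)) :
    (definingGauge A w).node b k →ₗ[ℂ] (Fin n → ℂ) :=
  (filt (resMat A b) (w b) (k.val + 1)).subtype

theorem gaugeIncl_injective (b : Option (Fin r)) (k : Fin (m b + 1)) :
    Function.Injective (gaugeIncl A w b k) := Subtype.val_injective

theorem gaugeIncl_outgoing (b : Option (Fin r)) (k : Fin (m b + 1))
    (v : (definingGauge A w).node b k) :
    gaugeIncl A w b k ((definingGauge A w).outgoing b k v) =
      (resMat A b - w b k.castSucc • 1) *ᵥ gaugeIncl A w b k v := by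
  induction k using Fin.cases with
  | zero => rw [StarRep.outgoing_zero]; rfl
  | succ k => rw [StarRep.outgoing_succ]; rfl

/-- At the last node of a branch the incoming part is zero by definition; there the formula holds
because the product of all the factors `A_b - w_{b,l}` vanishes. -/
theorem gaugeIncl_incoming
    (hP : ∀ b, Polynomial.aeval (resMat A b)
      (∏ l, (Polynomial.X - Polynomial.C (w b l))) = 0)
    (b : Option (Fin r)) (k : Fin (m b + 1)) (v : (definingGauge A w).node b k) :
    gaugeIncl A w b k ((definingGauge A w).incoming b k v) =
      (resMat A b - w b k.succ • 1) *ᵥ gaugeIncl A w b k v := by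
  induction k using Fin.lastCases with
  | last =>
    rw [StarRep.incoming_last]
    have hv : gaugeIncl A w b _ v ∈ filt (resMat A b) (w b) (Fin.last (m b)).succ := v.2
    obtain ⟨u, hu⟩ := mulVec_mem_filt (resMat A b) (w b) (Fin.last (m b)).succ _ hv
    have huniv : Finset.univ.filter
        (fun l : Fin (m b + 2) => l.val < (Fin.last (m b)).succ.val + 1) = Finset.univ := by
      ext l
      have := l.isLt
      simp
      omega
    rw [huniv, hP b, Matrix.mulVecLin_apply, Matrix.mulVecLin_apply, Matrix.zero_mulVec] at hu
    rw [← hu, LinearMap.zero_apply, map_zero]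
  | cast k => rw [StarRep.incoming_castSucc]; rfl

theorem definingGauge_isModule
    (hP : ∀ b, Polynomial.aeval (resMat A b)
      (∏ l, (Polynomial.X - Polynomial.C (w b l))) = 0) :
    (definingGauge A w).IsModule (couplingsOf w) := by
  constructor
  · have key : (∑ b, (resMat A b - w b 0 • 1).mulVecLin) +
        (∑ b, w b 0) • (LinearMap.id : (Fin n → ℂ) →ₗ[ℂ] (Fin n → ℂ)) = 0 := by
      refine LinearMap.ext fun v => ?_
      simp only [LinearMap.add_apply, LinearMap.sum_apply,
        Matrix.mulVecLin_apply, LinearMap.smul_apply, LinearMap.id_apply, Matrix.sub_mulVec,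
        Matrix.smul_mulVec, Matrix.one_mulVec, Finset.sum_sub_distrib, Finset.sum_smul]
      rw [← Matrix.sum_mulVec, sum_resMat]
      simp
    exact key
  · intro b k
    refine LinearMap.ext fun v => gaugeIncl_injective A w b k ?_
    rw [LinearMap.add_apply, LinearMap.sub_apply, map_add, map_sub, gaugeIncl_outgoing,
      gaugeIncl_incoming A w hP, LinearMap.smul_apply, map_smul, LinearMap.id_apply,
      LinearMap.zero_apply, map_zero]
    simp only [Matrix.sub_mulVec, Matrix.smul_mulVec, Matrix.one_mulVec, couplingsOf, sub_smul]
    abel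

theorem definingGauge_describes
    (hP : ∀ b, Polynomial.aeval (resMat A b)
      (∏ l, (Polynomial.X - Polynomial.C (w b l))) = 0) :
    Describes (definingGauge A w) A w where
  isModule := definingGauge_isModule A w hP
  inn_injective b := Subtype.val_injective
  innStar_surjective b := by
    rintro ⟨_, u, rfl⟩
    have h := aeval_prod_succ (resMat A b) (w b) 0
    simp only [Fin.val_zero, not_lt_zero, Finset.filter_false, Finset.prod_empty,
      map_one, mul_one] at h
    refine ⟨u, gaugeIncl_injective A w b 0 ?_⟩
    exact congrArg (fun M : Matrix (Fin n) (Fin n) ℂ => M *ᵥ (u : Fin n → ℂ)) h.symm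
  arr_injective b k :=
    Submodule.inclusion_injective (filt_succ_le (resMat A b) (w b) k.succ.castSucc)
  arrStar_surjective b k := by
    rintro ⟨_, u, rfl⟩
    have h := aeval_prod_succ (resMat A b) (w b) k.succ.castSucc
    refine ⟨⟨_, u, rfl⟩, gaugeIncl_injective A w b k.succ ?_⟩
    refine Eq.trans ?_
      (congrArg (fun M : Matrix (Fin n) (Fin n) ℂ => M *ᵥ (u : Fin n → ℂ)) h.symm)
    exact Matrix.mulVec_mulVec (u : Fin n → ℂ) (resMat A b - w b k.succ.castSucc • 1) _
  residue_eq := by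
    refine ⟨LinearEquiv.refl ℂ (Fin n → ℂ), fun b v => ?_⟩
    have key : resMat A b *ᵥ v = (resMat A b - w b 0 • 1) *ᵥ v + w b 0 • v := by
      simp [Matrix.sub_mulVec, Matrix.smul_mulVec]
    exact key

end DefiningGauge

/-! ### The reflection at the central node -/

namespace StarRep

variable {B : Type} [Fintype B] {m : B → ℕ} (X : StarRep B m)

theorem proj_apply (lam : ℂ) (x : ∀ b, X.node b 0) :
    X.proj lam x = -(lam⁻¹ • ∑ b, X.inn b (x b)) := by
  simp [proj]

theorem oneSub_apply (lam : ℂ) (x : ∀ b, X.node b 0) (b : B) :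
    X.oneSub lam x b = x b + lam⁻¹ • X.innStar b (∑ c, X.inn c (x c)) := by
  simp [oneSub, mu, proj_apply]

variable {X} {c : Couplings B m}

theorem IsModule.sum_inn_innStar (hX : X.IsModule c) (u : X.center) :
    ∑ b, X.inn b (X.innStar b u) = -(c.center • u) := by
  have := LinearMap.congr_fun hX.1 u
  simp only [LinearMap.add_apply, LinearMap.sum_apply, LinearMap.comp_apply,
    LinearMap.smul_apply, LinearMap.id_apply, LinearMap.zero_apply] at this
  exact eq_neg_of_add_eq_zero_left this

theorem IsModule.proj_mu (hX : X.IsModule c) (hc : c.center ≠ 0) (u : X.center) :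
    X.proj c.center (X.mu u) = u := by
  rw [proj_apply]
  simp [mu, hX.sum_inn_innStar, hc]

theorem IsModule.oneSub_mu (hX : X.IsModule c) (hc : c.center ≠ 0) (u : X.center) :
    X.oneSub c.center (X.mu u) = 0 := by
  simp [oneSub, hX.proj_mu hc]

theorem IsModule.oneSub_oneSub (hX : X.IsModule c) (hc : c.center ≠ 0) (x : ∀ b, X.node b 0) :
    X.oneSub c.center (X.oneSub c.center x) = X.oneSub c.center x := by
  conv_lhs => rw [oneSub, LinearMap.sub_apply, LinearMap.comp_apply, ← oneSub]
  conv_lhs => enter [2]; rw [oneSub]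
  simp [hX.proj_mu hc]

theorem IsModule.ker_oneSub (hX : X.IsModule c) (hc : c.center ≠ 0) :
    LinearMap.ker (X.oneSub c.center) = LinearMap.range X.mu := by
  ext x
  constructor
  · intro hx
    refine ⟨X.proj c.center x, ?_⟩
    have : x - X.mu (X.proj c.center x) = 0 := hx
    exact (sub_eq_zero.mp this).symm
  · rintro ⟨u, rfl⟩
    exact hX.oneSub_mu hc u

variable [DecidableEq B]

variable (X) in
/-- The inclusion of the central space of the reflected representation into `X_⊕`. -/
def reflectIncl (lam : ℂ) : (X.reflect lam).center →ₗ[ℂ] (∀ b, X.node b 0) :=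
  (LinearMap.range (X.oneSub lam)).subtype

theorem reflectIncl_injective (lam : ℂ) : Function.Injective (X.reflectIncl lam) :=
  Subtype.val_injective

variable (X) in
/-- The projection `1 - μπ` of `X_⊕` onto the central space of the reflected representation. -/
def reflectProj (lam : ℂ) : (∀ b, X.node b 0) →ₗ[ℂ] (X.reflect lam).center :=
  (X.oneSub lam).rangeRestrict

theorem reflectProj_surjective (lam : ℂ) : Function.Surjective (X.reflectProj lam) :=
  LinearMap.surjective_rangeRestrict _

theorem reflectIncl_reflectProj (lam : ℂ) (x : ∀ b, X.node b 0) :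
    X.reflectIncl lam (X.reflectProj lam x) = X.oneSub lam x := rfl

theorem reflect_inn_innStar (lam : ℂ) (b : B) (x : (X.reflect lam).center) :
    (X.reflect lam).inn b ((X.reflect lam).innStar b x) =
      lam • X.reflectProj lam (Pi.single b (X.reflectIncl lam x b)) := rfl

theorem IsModule.reflectProj_reflectIncl (hX : X.IsModule c) (hc : c.center ≠ 0)
    (x : (X.reflect c.center).center) :
    X.reflectProj c.center (X.reflectIncl c.center x) = x := by
  obtain ⟨y, rfl⟩ := reflectProj_surjective c.center x
  apply reflectIncl_injective
  rw [reflectIncl_reflectProj, reflectIncl_reflectProj, hX.oneSub_oneSub hc]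

theorem IsModule.reflect_sum (hX : X.IsModule c) (hc : c.center ≠ 0)
    (x : (X.reflect c.center).center) :
    ∑ b, (X.reflect c.center).inn b ((X.reflect c.center).innStar b x) = c.center • x := by
  simp only [reflect_inn_innStar]
  rw [← Finset.smul_sum, ← map_sum, Finset.univ_sum_single, hX.reflectProj_reflectIncl hc]

theorem sum_inn_single (b : B) (x : X.node b 0) :
    ∑ d, X.inn d ((Pi.single b x : ∀ b, X.node b 0) d) = X.inn b x := by
  rw [Finset.sum_eq_single b]
  · simp
  · intro d _ hd
    simp [Pi.single_eq_of_ne hd]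
  · simp

theorem reflect_innStar_inn {lam : ℂ} (hlam : lam ≠ 0) (b : B) (x : X.node b 0) :
    ((X.reflect lam).innStar b ((X.reflect lam).inn b x) : X.node b 0) =
      lam • x + X.innStar b (X.inn b x) := by
  have key : lam • X.oneSub lam (Pi.single b x) b = lam • x + X.innStar b (X.inn b x) := by
    rw [oneSub_apply, sum_inn_single]
    simp [hlam]
  exact key

theorem IsModule.reflect (hX : X.IsModule c) (hc : c.center ≠ 0) :
    (X.reflect c.center).IsModule c.reflect := by
  constructor
  · refine LinearMap.ext fun x => ?_
    simp only [LinearMap.add_apply, LinearMap.sum_apply, LinearMap.comp_apply,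
      LinearMap.smul_apply, LinearMap.id_apply, LinearMap.zero_apply, hX.reflect_sum hc]
    simp [Couplings.reflect]
  · intro b k
    have hin : (X.reflect c.center).incoming b k = X.incoming b k := by
      induction k using Fin.lastCases with
      | last => rw [incoming_last, incoming_last]; rfl
      | cast k => rw [incoming_castSucc, incoming_castSucc]; rfl
    have h := hX.2 b k
    suffices key : X.incoming b k - (show X.node b k →ₗ[ℂ] X.node b k from
        (X.reflect c.center).outgoing b k) + c.reflect.node b k • LinearMap.id = 0 by
      refine Eq.trans ?_ key
      rw [hin]
      rfl
    induction k using Fin.cases with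
    | zero =>
      have hout : (show X.node b 0 →ₗ[ℂ] X.node b 0 from (X.reflect c.center).outgoing b 0) =
          c.center • LinearMap.id + X.outgoing b 0 := by
        rw [outgoing_zero, outgoing_zero]
        exact LinearMap.ext fun x => reflect_innStar_inn hc b x
      have hnode : c.reflect.node b 0 = c.node b 0 + c.center := by simp [Couplings.reflect]
      rw [hout, hnode, ← h, add_smul]
      abel
    | succ k =>
      have hout : (show X.node b k.succ →ₗ[ℂ] X.node b k.succ from
          (X.reflect c.center).outgoing b k.succ) = X.outgoing b k.succ := by
        rw [outgoing_succ, outgoing_succ]; rfl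
      have hnode : c.reflect.node b k.succ = c.node b k.succ := by
        simp [Couplings.reflect, Fin.succ_ne_zero]
      rw [hout, hnode]
      exact h

end StarRep

theorem StarRep.IsModule.finrank_reflect {B : Type} [Fintype B] [DecidableEq B] {m : B → ℕ}
    {X : StarRep B m} {c : Couplings B m} (hX : X.IsModule c) (hc : c.center ≠ 0)
    [∀ b, FiniteDimensional ℂ (X.node b 0)] :
    Module.finrank ℂ (X.reflect c.center).center + Module.finrank ℂ X.center =
      ∑ b, Module.finrank ℂ (X.node b 0) := by
  have hinj : Function.Injective X.mu :=
    Function.LeftInverse.injective (g := X.proj c.center) (hX.proj_mu hc)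
  have h := LinearMap.finrank_range_add_finrank_ker (X.oneSub c.center)
  rw [hX.ker_oneSub hc, LinearMap.finrank_range_of_inj hinj, Module.finrank_pi_fintype] at h
  exact h

/-! ### Middle convolution -/

section Convolution

variable {n r : ℕ} (A : Fin r → Matrix (Fin n) (Fin n) ℂ) (lam : ℂ)

/-- The `i`-th block of a vector of `(ℂⁿ)^r`. -/
def block (i : Fin r) : (Fin r × Fin n → ℂ) →ₗ[ℂ] (Fin n → ℂ) :=
  LinearMap.funLeft ℂ ℂ (fun k : Fin n => ((i, k) : Fin r × Fin n))

theorem block_apply (i : Fin r) (v : Fin r × Fin n → ℂ) (k : Fin n) : block i v k = v (i, k) := rfl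

theorem ext_block {v w : Fin r × Fin n → ℂ} (h : ∀ i, block i v = block i w) : v = w := by
  ext ⟨i, k⟩
  exact congrFun (h i) k

theorem block_convMat_mulVec (i j : Fin r) (v : Fin r × Fin n → ℂ) :
    block j (convMat A lam i *ᵥ v) =
      if j = i then (∑ l, A l *ᵥ block l v) + lam • block i v else 0 := by
  ext k
  rw [block_apply, Matrix.mulVec, dotProduct]
  by_cases h : j = i
  · simp only [convMat, h, Matrix.of_apply, if_true, Fintype.sum_prod_type, Matrix.add_apply,
      add_mul, Finset.sum_add_distrib, Pi.add_apply, Finset.sum_apply, Pi.smul_apply]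
    congr 1
    rw [Finset.sum_eq_single i]
    · simp [Matrix.one_apply, block_apply]
    · intro l _ hl
      simp [hl]
    · simp
  · simp [convMat, h]

theorem block_sum_convMat_mulVec (j : Fin r) (v : Fin r × Fin n → ℂ) :
    block j ((∑ i, convMat A lam i) *ᵥ v) = (∑ l, A l *ᵥ block l v) + lam • block j v := by
  rw [Matrix.sum_mulVec, map_sum]
  simp [block_convMat_mulVec]

theorem mem_ker_sum_convMat {v : Fin r × Fin n → ℂ} :
    v ∈ LinearMap.ker (∑ i, convMat A lam i).mulVecLin ↔
      ∀ i, (∑ l, A l *ᵥ block l v) + lam • block i v = 0 := by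
  simp only [← block_sum_convMat_mulVec, LinearMap.mem_ker, Matrix.mulVecLin_apply]
  exact ⟨fun h i => by rw [h, map_zero], fun h => ext_block fun i => by rw [h, map_zero]⟩

theorem mem_iInf_ker {v : Fin r × Fin n → ℂ} :
    v ∈ (⨅ i, LinearMap.ker ((A i).mulVecLin ∘ₗ
      LinearMap.funLeft ℂ ℂ (fun k : Fin n => ((i, k) : Fin r × Fin n)))) ↔
      ∀ i, A i *ᵥ block i v = 0 := by
  simp [Submodule.mem_iInf, block]

theorem convMat_mulVec_mem_convKer (i : Fin r) {v : Fin r × Fin n → ℂ}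
    (hv : v ∈ convKer A lam) : convMat A lam i *ᵥ v ∈ convKer A lam := by
  revert v
  suffices h : convKer A lam ≤ (convKer A lam).comap (convMat A lam i).mulVecLin from
    fun v hv => h hv
  refine sup_le ?_ ?_
  · intro v hv
    rw [mem_iInf_ker] at hv
    refine Submodule.mem_sup_left ((mem_iInf_ker A).mpr fun j => ?_)
    rw [Matrix.mulVecLin_apply, block_convMat_mulVec]
    split_ifs with hj
    · simp [hv, hj, Matrix.mulVec_smul]
    · simp
  · intro v hv
    rw [mem_ker_sum_convMat] at hv
    have : convMat A lam i *ᵥ v = 0 := ext_block fun j => by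
      rw [block_convMat_mulVec, hv i]
      simp
    simp [this]

theorem exists_isMiddleConvolution :
    ∃ (n' : ℕ) (P : Matrix (Fin n') (Fin r × Fin n) ℂ) (A' : Fin r → Matrix (Fin n') (Fin n') ℂ),
      IsMiddleConvolution A lam P A' := by
  let V := convKer A lam
  let e : ((Fin r × Fin n → ℂ) ⧸ V) ≃ₗ[ℂ] (Fin (Module.finrank ℂ _) → ℂ) :=
    (Module.finBasis ℂ ((Fin r × Fin n → ℂ) ⧸ V)).equivFun
  let p : (Fin r × Fin n → ℂ) →ₗ[ℂ] (Fin (Module.finrank ℂ _) → ℂ) := e.toLinearMap ∘ₗ V.mkQ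
  let a : Fin r → (Fin (Module.finrank ℂ _) → ℂ) →ₗ[ℂ] (Fin (Module.finrank ℂ _) → ℂ) := fun i =>
    e.toLinearMap ∘ₗ V.mapQ V (convMat A lam i).mulVecLin
      (fun v hv => convMat_mulVec_mem_convKer A lam i hv) ∘ₗ e.symm.toLinearMap
  have hp : (LinearMap.toMatrix' p).mulVecLin = p := by
    rw [← Matrix.toLin'_apply', Matrix.toLin'_toMatrix']
  refine ⟨_, LinearMap.toMatrix' p, fun i => LinearMap.toMatrix' (a i), ?_, ?_, fun i => ?_⟩
  · rw [hp]
    exact e.surjective.comp V.mkQ_surjective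
  · rw [hp, LinearMap.ker_comp_of_ker_eq_bot _ e.ker, Submodule.ker_mkQ]
  · rw [← LinearMap.toMatrix'_comp]
    conv_rhs => rw [← LinearMap.toMatrix'_toLin' (convMat A lam i), ← LinearMap.toMatrix'_comp]
    congr 1
    refine LinearMap.ext fun v => ?_
    simp only [a, p, LinearMap.comp_apply, LinearEquiv.coe_coe, LinearEquiv.symm_apply_apply]
    rfl

end Convolution

/-! ### Middle convolution as reflection -/

section Reflection

variable {n r : ℕ} {m : Option (Fin r) → ℕ} {A : Fin r → Matrix (Fin n) (Fin n) ℂ}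
  {w : ∀ b, Fin (m b + 2) → ℂ} {X : StarRep (Option (Fin r)) m}

variable (X) in
/-- The map `(ℂⁿ)^r → X_⊕` with components `X^*_{i,1}` at the finite points and `0` at infinity,
for an identification `e` of `X_⋆` with `ℂⁿ`. -/
def finiteStar (e : (Fin n → ℂ) ≃ₗ[ℂ] X.center) :
    (Fin r × Fin n → ℂ) →ₗ[ℂ] (∀ b, X.node b 0) :=
  LinearMap.pi fun b => match b with
    | none => 0
    | some i => X.innStar (some i) ∘ₗ e.toLinearMap ∘ₗ block i

theorem finiteStar_none (e : (Fin n → ℂ) ≃ₗ[ℂ] X.center) (v : Fin r × Fin n → ℂ) :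
    finiteStar X e v none = 0 := rfl

theorem finiteStar_some (e : (Fin n → ℂ) ≃ₗ[ℂ] X.center) (v : Fin r × Fin n → ℂ) (i : Fin r) :
    finiteStar X e v (some i) = X.innStar (some i) (e (block i v)) := rfl

variable (X) in
/-- The map `(ℂⁿ)^r → X'_⋆` that identifies the space of the middle convolution with the central
space of the reflected module. -/
def convToReflect (lam : ℂ) (e : (Fin n → ℂ) ≃ₗ[ℂ] X.center) :
    (Fin r × Fin n → ℂ) →ₗ[ℂ] (X.reflect lam).center :=
  X.reflectProj lam ∘ₗ finiteStar X e

/-- The identification `e` of `ℂⁿ` with `X_⋆` carries the residues `A_b` of the system to those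
of `X`. -/
def IsFrame (X : StarRep (Option (Fin r)) m) (A : Fin r → Matrix (Fin n) (Fin n) ℂ)
    (w : ∀ b, Fin (m b + 2) → ℂ) (e : (Fin n → ℂ) ≃ₗ[ℂ] X.center) : Prop :=
  ∀ b v, e (resMat A b *ᵥ v) = X.residue (fun b => w b 0) b (e v)

variable {e : (Fin n → ℂ) ≃ₗ[ℂ] X.center}

theorem IsFrame.inn_innStar_some (he : IsFrame X A w e) (hnorm : ∀ i, w (some i) 0 = 0)
    (i : Fin r) (v : Fin n → ℂ) :
    X.inn (some i) (X.innStar (some i) (e v)) = e (A i *ᵥ v) := by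
  have h := he (some i) v
  simp only [StarRep.residue, LinearMap.comp_apply, hnorm, zero_smul, add_zero] at h
  exact h.symm

theorem sum_exponents (hnorm : ∀ i, w (some i) 0 = 0) :
    (couplingsOf w).center = w none 0 := by
  simp [couplingsOf, Fintype.sum_option, hnorm]

theorem IsFrame.inn_innStar_none (he : IsFrame X A w e) (hnorm : ∀ i, w (some i) 0 = 0)
    (v : Fin n → ℂ) :
    X.inn none (X.innStar none (e v)) =
      -e ((∑ i, A i *ᵥ v) + (couplingsOf w).center • v) := by
  have h := he none v
  simp only [StarRep.residue, LinearMap.add_apply, LinearMap.comp_apply, resMat,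
    LinearMap.smul_apply, LinearMap.id_apply, Matrix.neg_mulVec, Matrix.sum_mulVec] at h
  rw [eq_comm, ← eq_sub_iff_add_eq] at h
  rw [h, sum_exponents hnorm, map_neg, map_add, map_smul]
  abel

theorem IsFrame.innStar_some_eq_zero (he : IsFrame X A w e) (hX : Describes X A w)
    (hnorm : ∀ i, w (some i) 0 = 0) {i : Fin r} {v : Fin n → ℂ} :
    X.innStar (some i) (e v) = 0 ↔ A i *ᵥ v = 0 := by
  rw [← map_eq_zero_iff _ (hX.inn_injective (some i)), he.inn_innStar_some hnorm,
    map_eq_zero_iff _ e.injective]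

theorem IsFrame.innStar_none_eq_zero (he : IsFrame X A w e) (hX : Describes X A w)
    (hnorm : ∀ i, w (some i) 0 = 0) {v : Fin n → ℂ} :
    X.innStar none (e v) = 0 ↔ (∑ i, A i *ᵥ v) + (couplingsOf w).center • v = 0 := by
  rw [← map_eq_zero_iff _ (hX.inn_injective none), he.inn_innStar_none hnorm,
    neg_eq_zero, map_eq_zero_iff _ e.injective]

/-- The summand of `X_⊕` at infinity is not needed to generate `X'_⋆`, because `1 - μπ` kills the
image of `μ` and `X^*_{∞,1}` is surjective. -/
theorem convToReflect_surjective (hX : Describes X A w) (hlam0 : (couplingsOf w).center ≠ 0) :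
    Function.Surjective (convToReflect X (couplingsOf w).center e) := by
  intro y
  obtain ⟨x, rfl⟩ := StarRep.reflectProj_surjective _ y
  obtain ⟨u, hu⟩ := hX.innStar_surjective none (x none)
  choose t ht using fun i => hX.innStar_surjective (some i) (x (some i) - X.innStar (some i) u)
  refine ⟨fun q => e.symm (t q.1) q.2, ?_⟩
  have hx : x = finiteStar X e (fun q => e.symm (t q.1) q.2) + X.mu u := by
    funext b
    cases b with
    | none => rw [Pi.add_apply, finiteStar_none, zero_add, ← hu]; rfl
    | some i =>
      have hb : e (block i (fun q : Fin r × Fin n => e.symm (t q.1) q.2)) = t i :=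
        e.apply_symm_apply (t i)
      rw [Pi.add_apply, finiteStar_some, hb, ht]
      simp [StarRep.mu]
  apply StarRep.reflectIncl_injective
  rw [convToReflect, LinearMap.comp_apply, StarRep.reflectIncl_reflectProj,
    StarRep.reflectIncl_reflectProj]
  conv_rhs => rw [hx]
  rw [map_add, hX.isModule.oneSub_mu hlam0, add_zero]

theorem ker_convToReflect (he : IsFrame X A w e) (hX : Describes X A w)
    (hnorm : ∀ i, w (some i) 0 = 0) (hlam0 : (couplingsOf w).center ≠ 0) :
    LinearMap.ker (convToReflect X (couplingsOf w).center e) =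
      convKer A (couplingsOf w).center := by
  have hker : ∀ v, v ∈ LinearMap.ker (convToReflect X (couplingsOf w).center e) ↔
      ∃ u, X.mu u = finiteStar X e v := by
    intro v
    rw [LinearMap.mem_ker, ← map_eq_zero_iff _ (StarRep.reflectIncl_injective _), convToReflect,
      LinearMap.comp_apply, StarRep.reflectIncl_reflectProj, ← LinearMap.mem_ker,
      hX.isModule.ker_oneSub hlam0, LinearMap.mem_range]
  refine le_antisymm (fun v hv => ?_) (sup_le (fun v hv => ?_) fun v hv => ?_)
  · obtain ⟨u, hu⟩ := (hker v).mp hv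
    obtain ⟨u, rfl⟩ := e.surjective u
    have hnone : X.innStar none (e u) = 0 := congrFun hu none
    have hsome : ∀ i, X.innStar (some i) (e u) = X.innStar (some i) (e (block i v)) :=
      fun i => congrFun hu (some i)
    -- `v` is the sum of `(v_i - u)_i`, killed by all `A_i`, and of the constant family `u`.
    have hv' : v = (v - fun q => u q.2) + fun q => u q.2 := by simp
    rw [hv']
    refine Submodule.add_mem_sup ((mem_iInf_ker A).mpr fun i => ?_)
      ((mem_ker_sum_convMat A _).mpr fun i => ?_)
    · rw [← he.innStar_some_eq_zero hX hnorm, map_sub, map_sub, map_sub]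
      exact sub_eq_zero.mpr (hsome i).symm
    · exact (he.innStar_none_eq_zero hX hnorm).mp hnone
  · refine (hker v).mpr ⟨0, ?_⟩
    rw [map_zero]
    funext b
    cases b with
    | none => rfl
    | some i =>
      rw [finiteStar_some,
        (he.innStar_some_eq_zero hX hnorm).mpr ((mem_iInf_ker A).mp hv i)]
      rfl
  · rw [mem_ker_sum_convMat] at hv
    -- All blocks of `v` are equal to `u`.
    set u : Fin n → ℂ := -((couplingsOf w).center⁻¹ • ∑ l, A l *ᵥ block l v) with hu
    have hblock : ∀ i, block i v = u := fun i => by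
      rw [hu, eq_neg_of_add_eq_zero_left (hv i)]
      simp [hlam0]
    refine (hker v).mpr ⟨e u, ?_⟩
    funext b
    cases b with
    | none =>
      refine (he.innStar_none_eq_zero hX hnorm).mpr ?_
      simp only [hblock] at hu
      conv_lhs => enter [2]; rw [hu]
      simp [hlam0]
    | some i => rw [finiteStar_some, hblock]; rfl

theorem convToReflect_convMat (he : IsFrame X A w e)
    (hnorm : ∀ i, w (some i) 0 = 0) (hlam0 : (couplingsOf w).center ≠ 0)
    (i : Fin r) (v : Fin r × Fin n → ℂ) :
    convToReflect X (couplingsOf w).center e (convMat A (couplingsOf w).center i *ᵥ v) =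
      (X.reflect (couplingsOf w).center).inn (some i)
        ((X.reflect (couplingsOf w).center).innStar (some i)
          (convToReflect X (couplingsOf w).center e v)) := by
  set lam := (couplingsOf w).center with hlam
  rw [StarRep.reflect_inn_innStar, convToReflect, LinearMap.comp_apply, LinearMap.comp_apply,
    StarRep.reflectIncl_reflectProj, ← map_smul]
  congr 1
  rw [← Pi.single_smul, StarRep.oneSub_apply, finiteStar_some]
  have hsum : ∑ b, X.inn b (finiteStar X e v b) = e (∑ l, A l *ᵥ block l v) := by
    rw [Fintype.sum_option, finiteStar_none, map_zero, zero_add, map_sum]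
    exact Finset.sum_congr rfl fun l _ => he.inn_innStar_some hnorm l _
  rw [hsum, smul_add, smul_inv_smul₀ hlam0, add_comm, ← map_smul, ← map_smul, ← map_add, ← map_add]
  funext b
  cases b with
  | none => rw [finiteStar_none, Pi.single_eq_of_ne (by simp)]
  | some j =>
    rw [finiteStar_some, block_convMat_mulVec]
    by_cases hj : j = i
    · subst hj
      rw [if_pos rfl, Pi.single_eq_same]
    · rw [if_neg hj, map_zero, map_zero, Pi.single_eq_of_ne (by simpa using hj)]

/-- Both `P` and `convToReflect` are surjective with kernel `V`, so the two quotients of `(ℂⁿ)^r`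
are isomorphic; at infinity the residues agree by the relation at the central node. -/
theorem IsMiddleConvolution.exists_equiv_reflect {n' : ℕ} {P : Matrix (Fin n') (Fin r × Fin n) ℂ}
    {A' : Fin r → Matrix (Fin n') (Fin n') ℂ}
    (hP : IsMiddleConvolution A (couplingsOf w).center P A') (hX : Describes X A w)
    (hnorm : ∀ i, w (some i) 0 = 0) (hlam0 : (couplingsOf w).center ≠ 0) :
    ∃ f : (Fin n' → ℂ) ≃ₗ[ℂ] (X.reflect (couplingsOf w).center).center,
      ∀ b v, f (resMat A' b *ᵥ v) =
        (X.reflect (couplingsOf w).center).residue (normExp (-(couplingsOf w).center)) b (f v) := by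
  obtain ⟨e, he⟩ := hX.residue_eq
  let f := (P.mulVecLin.quotKerEquivOfSurjective hP.surjective).symm ≪≫ₗ
    Submodule.quotEquivOfEq _ _ (hP.ker_eq.trans (ker_convToReflect he hX hnorm hlam0).symm) ≪≫ₗ
    (convToReflect X (couplingsOf w).center e).quotKerEquivOfSurjective
      (convToReflect_surjective hX hlam0)
  have hf : ∀ v, f (P *ᵥ v) = convToReflect X (couplingsOf w).center e v := by
    intro v
    have h1 : (P.mulVecLin.quotKerEquivOfSurjective hP.surjective).symm (P *ᵥ v) =
        Submodule.Quotient.mk v := by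
      rw [LinearEquiv.symm_apply_eq]
      rfl
    simp only [f, LinearEquiv.trans_apply, h1]
    rfl
  have hsome : ∀ i v, f (A' i *ᵥ v) = (X.reflect (couplingsOf w).center).inn (some i)
      ((X.reflect (couplingsOf w).center).innStar (some i) (f v)) := by
    intro i v
    obtain ⟨v, rfl⟩ := hP.surjective v
    rw [Matrix.mulVecLin_apply, Matrix.mulVec_mulVec, hP.intertwines, ← Matrix.mulVec_mulVec, hf,
      hf, convToReflect_convMat he hnorm hlam0]
  refine ⟨f, fun b v => ?_⟩
  rw [StarRep.residue, LinearMap.add_apply, LinearMap.comp_apply, LinearMap.smul_apply,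
    LinearMap.id_apply]
  cases b with
  | none =>
    have h := hX.isModule.reflect_sum hlam0 (f v)
    rw [Fintype.sum_option, ← eq_sub_iff_add_eq] at h
    rw [h]
    simp only [resMat, normExp, Matrix.neg_mulVec, Matrix.sum_mulVec, map_neg, map_sum, hsome,
      neg_smul]
    abel
  | some i => simp [resMat, normExp, hsome]

/-- The order of the middle convolution is the dimension of the image of the projection `1 - μπ`
for the module of the system. -/
theorem IsMiddleConvolution.order_add {n' : ℕ} {P : Matrix (Fin n') (Fin r × Fin n) ℂ}
    {A' : Fin r → Matrix (Fin n') (Fin n') ℂ}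
    (hP : IsMiddleConvolution A (couplingsOf w).center P A')
    (hw : ∀ b, Polynomial.aeval (resMat A b)
      (∏ l, (Polynomial.X - Polynomial.C (w b l))) = 0)
    (hnorm : ∀ i, w (some i) 0 = 0) (hlam0 : (couplingsOf w).center ≠ 0) :
    n' + n = ∑ b, Module.finrank ℂ (filt (resMat A b) (w b) 1) := by
  have hX := definingGauge_describes A w hw
  obtain ⟨f, -⟩ := hP.exists_equiv_reflect hX hnorm hlam0
  have : ∀ b, FiniteDimensional ℂ ((definingGauge A w).node b 0) := fun b =>
    inferInstanceAs (FiniteDimensional ℂ (filt (resMat A b) (w b) 1))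
  have h := hX.isModule.finrank_reflect hlam0
  rw [← f.finrank_eq, Module.finrank_fin_fun] at h
  have hn : Module.finrank ℂ (definingGauge A w).center = n := Module.finrank_fin_fun ℂ
  rw [hn] at h
  exact h

end Reflection

/-! ### Piecewise continuously differentiable paths -/

/-- A path which is piecewise continuously differentiable on `[a, b]`. -/
def PiecewiseC1On (γ : ℝ → ℂ) (a b : ℝ) : Prop :=
  ∃ (N : ℕ) (t : ℕ → ℝ), Monotone t ∧ t 0 = a ∧ t N = b ∧
    ∀ k < N, ContDiffOn ℝ 1 γ (Set.Icc (t k) (t (k + 1)))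

theorem PiecewiseC1On.continuousOn {γ : ℝ → ℂ} {a b : ℝ} (hγ : PiecewiseC1On γ a b) :
    ContinuousOn γ (Set.Icc a b) := by
  obtain ⟨N, t, ht, rfl, rfl, hC⟩ := hγ
  induction N with
  | zero => simp
  | succ N ih =>
    rw [← Set.Icc_union_Icc_eq_Icc (ht (Nat.zero_le N)) (ht (Nat.le_succ N))]
    exact (ih fun k hk => hC k (by omega)).union_of_isClosed (hC N (by omega)).continuousOn
      isClosed_Icc isClosed_Icc

theorem PiecewiseC1On.exists_finite_differentiableAt {γ : ℝ → ℂ} {a b : ℝ}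
    (hγ : PiecewiseC1On γ a b) :
    ∃ s : Set ℝ, s.Finite ∧ ∀ x ∈ Set.Ioo a b \ s, DifferentiableAt ℝ γ x := by
  obtain ⟨N, t, ht, rfl, rfl, hC⟩ := hγ
  induction N with
  | zero => exact ⟨∅, Set.finite_empty, by simp⟩
  | succ N ih =>
    obtain ⟨s, hs, h⟩ := ih fun k hk => hC k (by omega)
    refine ⟨insert (t N) s, hs.insert _, fun x ⟨hx, hxs⟩ => ?_⟩
    rw [Set.mem_insert_iff, not_or] at hxs
    rcases lt_or_gt_of_ne hxs.1 with hlt | hlt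
    · exact h x ⟨⟨hx.1, hlt⟩, hxs.2⟩
    · exact ((hC N (by omega)).differentiableOn one_ne_zero).differentiableAt
        (Icc_mem_nhds hlt hx.2)

theorem PiecewiseC1On.intervalIntegrable_deriv {γ : ℝ → ℂ} {a b : ℝ}
    (hγ : PiecewiseC1On γ a b) : IntervalIntegrable (deriv γ) MeasureTheory.volume a b := by
  obtain ⟨N, t, ht, rfl, rfl, hC⟩ := hγ
  refine IntervalIntegrable.trans_iterate fun k hk => ?_
  rcases (ht (Nat.le_succ k)).eq_or_lt with heq | hlt
  · rw [← heq]
  · have hcont := (hC k hk).continuousOn_derivWithin (uniqueDiffOn_Icc hlt) le_rfl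
    have hint : IntervalIntegrable (derivWithin γ (Set.Icc (t k) (t (k + 1))))
        MeasureTheory.volume (t k) (t (k + 1)) := hcont.intervalIntegrable_of_Icc hlt.le
    refine hint.congr_uIoo fun x hx => ?_
    rw [Set.uIoo_of_le hlt.le] at hx
    exact derivWithin_of_mem_nhds (Icc_mem_nhds hx.1 hx.2)

/-! ### Branches of the logarithm and of solutions along a path -/

/-- A continuous logarithm of `f` differs from `log (f / f x)` by a constant near `x`. -/
theorem eventually_eq_add_log {X : Type*} [TopologicalSpace X] {ℓ f : X → ℂ} {x : X}
    (hℓ : ContinuousAt ℓ x) (hf : ∀ᶠ u in 𝓝 x, Complex.exp (ℓ u) = f u) :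
    ∀ᶠ u in 𝓝 x, ℓ u = ℓ x + Complex.log (f u / f x) := by
  have him : ContinuousAt (fun u => (ℓ u - ℓ x).im) x :=
    Complex.continuous_im.continuousAt.comp (hℓ.sub continuousAt_const)
  have h0 : (ℓ x - ℓ x).im = 0 := by simp
  have h1 : ∀ᶠ u in 𝓝 x, (ℓ u - ℓ x).im ∈ Set.Ioo (-Real.pi) Real.pi := by
    refine him.eventually (isOpen_Ioo.mem_nhds ?_)
    simp only [h0]
    exact ⟨neg_lt_zero.mpr Real.pi_pos, Real.pi_pos⟩
  filter_upwards [h1, hf] with u hu hfu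
  rw [← hfu, ← hf.self_of_nhds, ← Complex.exp_sub, Complex.log_exp hu.1 hu.2.le]
  ring

theorem hasDerivAt_of_exp_eq {ℓ f : ℂ → ℂ} {f' x : ℂ} (hℓ : ContinuousAt ℓ x)
    (hf : ∀ᶠ u in 𝓝 x, Complex.exp (ℓ u) = f u) (hf' : HasDerivAt f f' x) :
    HasDerivAt ℓ (f' / f x) x := by
  have h0 : f x ≠ 0 := hf.self_of_nhds ▸ Complex.exp_ne_zero _
  have h := ((hf'.div_const (f x)).clog (by simp [h0])).const_add (ℓ x)
  rw [div_self h0, div_one] at h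
  exact h.congr_of_eventuallyEq (eventually_eq_add_log hℓ hf)

theorem hasDerivAt_of_exp_eq_real {ℓ f : ℝ → ℂ} {f' : ℂ} {x : ℝ} (hℓ : ContinuousAt ℓ x)
    (hf : ∀ᶠ u in 𝓝 x, Complex.exp (ℓ u) = f u) (hf' : HasDerivAt f f' x) :
    HasDerivAt ℓ (f' / f x) x := by
  have h0 : f x ≠ 0 := hf.self_of_nhds ▸ Complex.exp_ne_zero _
  have h := ((hf'.div_const (f x)).clog_real (by simp [h0])).const_add (ℓ x)
  rw [div_self h0, div_one] at h
  exact h.congr_of_eventuallyEq (eventually_eq_add_log hℓ hf)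

/-- `y` is a branch along the restriction of `γ` to `[a, b]` of a solution of the system. -/
def IsSolutionOn {n r : ℕ} (z : Fin r → ℂ) (A : Fin r → Matrix (Fin n) (Fin n) ℂ)
    (γ : ℝ → ℂ) (y : ℝ → Fin n → ℂ) (a b : ℝ) : Prop :=
  ∀ t ∈ Set.Icc a b, ∃ F : ℂ → Fin n → ℂ,
    (∀ᶠ x in 𝓝 (γ t), SolvesAt z A F x) ∧ ∀ᶠ u in 𝓝[Set.Icc a b] t, y u = F (γ u)

section Solution

variable {n r : ℕ} {z : Fin r → ℂ} {A : Fin r → Matrix (Fin n) (Fin n) ℂ}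
  {γ : ℝ → ℂ} {y : ℝ → Fin n → ℂ} {a b : ℝ}

theorem IsSolutionOn.continuousOn (hy : IsSolutionOn z A γ y a b)
    (hγ : ContinuousOn γ (Set.Icc a b)) : ContinuousOn y (Set.Icc a b) := by
  intro t ht
  obtain ⟨F, hF, hyF⟩ := hy t ht
  refine ContinuousWithinAt.congr_of_eventuallyEq ?_ hyF (hyF.self_of_nhdsWithin ht)
  exact ContinuousAt.comp_continuousWithinAt (f := γ) (g := F)
    (HasDerivAt.continuousAt hF.self_of_nhds) (hγ t ht)

theorem IsSolutionOn.hasDerivAt (hy : IsSolutionOn z A γ y a b) {t : ℝ} (ht : t ∈ Set.Ioo a b)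
    {γ' : ℂ} (hγ : HasDerivAt γ γ' t) :
    HasDerivAt y (γ' • ∑ i, (γ t - z i)⁻¹ • (A i *ᵥ y t)) t := by
  obtain ⟨F, hF, hyF⟩ := hy t (Set.Ioo_subset_Icc_self ht)
  rw [nhdsWithin_eq_nhds.mpr (Icc_mem_nhds ht.1 ht.2)] at hyF
  have h : HasDerivAt F (∑ i, (γ t - z i)⁻¹ • (A i *ᵥ F (γ t))) (γ t) := hF.self_of_nhds
  rw [hyF.self_of_nhds]
  exact (HasDerivAt.scomp t h hγ).congr_of_eventuallyEq hyF

end Solution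

/-! ### Integrals over twisted cycles -/

/-- Differentiation under the integral sign for an integrable weight `d` and a kernel which is
continuous in both variables and holomorphic in the parameter. -/
theorem hasDerivAt_integral_smul_of_continuousOn {E : Type*} [NormedAddCommGroup E]
    [NormedSpace ℂ E] {d : ℝ → ℂ} {g g' : ℂ → ℝ → E} {D : Set ℂ}
    (hD : IsOpen D) (hd : IntervalIntegrable d MeasureTheory.volume 0 1)
    (hg : ContinuousOn (fun q : ℂ × ℝ => g q.1 q.2) (D ×ˢ Set.Icc (0 : ℝ) 1))
    (hg' : ContinuousOn (fun q : ℂ × ℝ => g' q.1 q.2) (D ×ˢ Set.Icc (0 : ℝ) 1))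
    (hderiv : ∀ ζ ∈ D, ∀ t ∈ Set.Icc (0 : ℝ) 1, HasDerivAt (fun ζ => g ζ t) (g' ζ t) ζ)
    {ζ : ℂ} (hζ : ζ ∈ D) :
    HasDerivAt (fun ζ => ∫ t in (0 : ℝ)..1, d t • g ζ t) (∫ t in (0 : ℝ)..1, d t • g' ζ t) ζ := by
  have slice : ∀ {k : ℂ → ℝ → E},
      ContinuousOn (fun q : ℂ × ℝ => k q.1 q.2) (D ×ˢ Set.Icc (0 : ℝ) 1) → ∀ x ∈ D,
      IntervalIntegrable (fun t => d t • k x t) MeasureTheory.volume 0 1 := by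
    intro k hk x hx
    refine hd.smul_continuousOn ?_
    rw [Set.uIcc_of_le zero_le_one]
    exact hk.comp (f := fun t : ℝ => (x, t)) (by fun_prop) fun t ht => ⟨hx, ht⟩
  obtain ⟨δ, hδ, hball⟩ := Metric.nhds_basis_closedBall.mem_iff.mp (hD.mem_nhds hζ)
  obtain ⟨C, hC⟩ := ((isCompact_closedBall ζ δ).prod (isCompact_Icc (a := (0 : ℝ)) (b := 1))
    ).exists_bound_of_continuousOn (hg'.mono (Set.prod_mono hball subset_rfl))
  have hIoc : ∀ {t : ℝ}, t ∈ Set.uIoc (0 : ℝ) 1 → t ∈ Set.Icc (0 : ℝ) 1 := fun ht => by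
    rw [Set.uIoc_of_le zero_le_one] at ht
    exact Set.Ioc_subset_Icc_self ht
  refine (intervalIntegral.hasDerivAt_integral_of_dominated_loc_of_deriv_le
    (F' := fun ζ t => d t • g' ζ t) (bound := fun t => ‖d t‖ * C)
    (Metric.closedBall_mem_nhds ζ hδ) ?_ (slice hg ζ hζ) ?_ ?_ (hd.norm.mul_const C) ?_).2
  · filter_upwards [hD.mem_nhds hζ] with x hx
    exact (intervalIntegrable_iff.mp (slice hg x hx)).aestronglyMeasurable
  · exact (intervalIntegrable_iff.mp (slice hg' ζ hζ)).aestronglyMeasurable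
  · refine Filter.Eventually.of_forall fun t ht x hx => ?_
    rw [norm_smul]
    exact mul_le_mul_of_nonneg_left (hC (x, t) ⟨hx, hIoc ht⟩) (norm_nonneg _)
  · refine Filter.Eventually.of_forall fun t ht x hx => ?_
    exact (hderiv x (hball hx) t (hIoc ht)).const_smul (d t)

/-- The integral `∫_γ φ(s) Y(s) ds` along a contour carrying a branch `y` of `Y`. -/
def contourIntegral {n : ℕ} (γ : ℝ → ℂ) (y : ℝ → Fin n → ℂ) (φ : ℝ → ℂ) : Fin n → ℂ :=
  ∫ t in (0 : ℝ)..1, deriv γ t • (φ t • y t)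

/-- The kernel `(ζ - s)^lam / (s - z_i)`. -/
def rlKernel {r : ℕ} (z : Fin r → ℂ) (lam : ℂ) (γ : ℝ → ℂ) (L : ℂ → ℝ → ℂ) (i : Fin r)
    (ζ : ℂ) (t : ℝ) : ℂ :=
  (γ t - z i)⁻¹ * Complex.exp (lam * L ζ t)

/-- The derivative in `ζ` of `(ζ - s)^lam`. -/
def dPow (lam : ℂ) (γ : ℝ → ℂ) (L : ℂ → ℝ → ℂ) (ζ : ℂ) (t : ℝ) : ℂ :=
  Complex.exp (lam * L ζ t) * (lam * (ζ - γ t)⁻¹)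

/-- All components `∫_γ Y(s) (ζ - s)^lam / (s - z_i) ds`, as a vector of `(ℂⁿ)^r`. -/
def rlVector {n r : ℕ} (z : Fin r → ℂ) (lam : ℂ) (γ : ℝ → ℂ) (y : ℝ → Fin n → ℂ)
    (L : ℂ → ℝ → ℂ) (ζ : ℂ) : Fin r × Fin n → ℂ :=
  fun q => contourIntegral γ y (rlKernel z lam γ L q.1 ζ) q.2

namespace IsTwistedCycle

variable {n r : ℕ} {z : Fin r → ℂ} {A : Fin r → Matrix (Fin n) (Fin n) ℂ} {lam : ℂ} {D : Set ℂ}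
  {γ : ℝ → ℂ} {y : ℝ → Fin n → ℂ} {L : ℂ → ℝ → ℂ} {ζ : ℂ}

theorem continuousOn_path (h : IsTwistedCycle z A lam D γ y L) :
    ContinuousOn γ (Set.Icc (0 : ℝ) 1) :=
  PiecewiseC1On.continuousOn h.piecewiseC1

theorem continuousOn_branch (h : IsTwistedCycle z A lam D γ y L) :
    ContinuousOn y (Set.Icc (0 : ℝ) 1) :=
  IsSolutionOn.continuousOn h.solution h.continuousOn_path

theorem sub_ne_zero (h : IsTwistedCycle z A lam D γ y L) (hζ : ζ ∈ D) {t : ℝ}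
    (ht : t ∈ Set.Icc (0 : ℝ) 1) : ζ - γ t ≠ 0 :=
  h.exp_log ζ hζ t ht ▸ Complex.exp_ne_zero _

theorem intervalIntegrable (h : IsTwistedCycle z A lam D γ y L) {φ : ℝ → ℂ}
    (hφ : ContinuousOn φ (Set.Icc (0 : ℝ) 1)) :
    IntervalIntegrable (fun t => deriv γ t • (φ t • y t)) MeasureTheory.volume 0 1 := by
  refine (PiecewiseC1On.intervalIntegrable_deriv h.piecewiseC1).smul_continuousOn ?_
  rw [Set.uIcc_of_le zero_le_one]
  exact hφ.smul h.continuousOn_branch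

theorem mulVec_contourIntegral (h : IsTwistedCycle z A lam D γ y L) {φ : ℝ → ℂ}
    (hφ : ContinuousOn φ (Set.Icc (0 : ℝ) 1)) {p : ℕ} (M : Matrix (Fin p) (Fin n) ℂ) :
    M *ᵥ contourIntegral γ y φ = ∫ t in (0 : ℝ)..1, deriv γ t • (φ t • (M *ᵥ y t)) := by
  have := (LinearMap.toContinuousLinearMap M.mulVecLin).intervalIntegral_comp_comm
    (h.intervalIntegrable hφ)
  simp only [LinearMap.coe_toContinuousLinearMap', Matrix.mulVecLin_apply, Matrix.mulVec_smul]
    at this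
  exact this.symm

theorem contourIntegral_add (h : IsTwistedCycle z A lam D γ y L) {φ ψ : ℝ → ℂ}
    (hφ : ContinuousOn φ (Set.Icc (0 : ℝ) 1)) (hψ : ContinuousOn ψ (Set.Icc (0 : ℝ) 1)) :
    contourIntegral γ y (fun t => φ t + ψ t) = contourIntegral γ y φ + contourIntegral γ y ψ := by
  rw [contourIntegral, contourIntegral, contourIntegral,
    ← intervalIntegral.integral_add (h.intervalIntegrable hφ) (h.intervalIntegrable hψ)]
  simp only [add_smul, smul_add]

theorem _root_.Fuchs.contourIntegral_const_mul (c : ℂ) (φ : ℝ → ℂ) :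
    contourIntegral γ y (fun t => c * φ t) = c • contourIntegral γ y φ := by
  rw [contourIntegral, contourIntegral, ← intervalIntegral.integral_smul]
  refine intervalIntegral.integral_congr fun t _ => ?_
  simp only [mul_smul]
  rw [smul_comm]

theorem _root_.Fuchs.contourIntegral_congr {φ ψ : ℝ → ℂ}
    (hφψ : ∀ t ∈ Set.Icc (0 : ℝ) 1, φ t = ψ t) :
    contourIntegral γ y φ = contourIntegral γ y ψ := by
  refine intervalIntegral.integral_congr fun t ht => ?_
  rw [Set.uIcc_of_le zero_le_one] at ht
  simp only [hφψ t ht]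

theorem continuousOn_exp (h : IsTwistedCycle z A lam D γ y L) :
    ContinuousOn (fun q : ℂ × ℝ => Complex.exp (lam * L q.1 q.2)) (D ×ˢ Set.Icc (0 : ℝ) 1) :=
  (continuousOn_const.mul h.log_continuous).cexp

theorem continuousOn_snd (h : IsTwistedCycle z A lam D γ y L) :
    ContinuousOn (fun q : ℂ × ℝ => γ q.2) (D ×ˢ Set.Icc (0 : ℝ) 1) :=
  h.continuousOn_path.comp _root_.continuousOn_snd fun _ hq => hq.2

theorem continuousOn_rlKernel (h : IsTwistedCycle z A lam D γ y L) (i : Fin r) :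
    ContinuousOn (fun q : ℂ × ℝ => rlKernel z lam γ L i q.1 q.2) (D ×ˢ Set.Icc (0 : ℝ) 1) := by
  refine ContinuousOn.mul (ContinuousOn.inv₀ (h.continuousOn_snd.sub continuousOn_const) ?_)
    h.continuousOn_exp
  exact fun q hq => _root_.sub_ne_zero.mpr (h.avoids _ hq.2 i)

theorem continuousOn_dPow (h : IsTwistedCycle z A lam D γ y L) :
    ContinuousOn (fun q : ℂ × ℝ => dPow lam γ L q.1 q.2) (D ×ˢ Set.Icc (0 : ℝ) 1) := by
  refine h.continuousOn_exp.mul (continuousOn_const.mul (ContinuousOn.inv₀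
    (continuousOn_fst.sub h.continuousOn_snd) fun q hq => h.sub_ne_zero hq.1 hq.2))

theorem _root_.Fuchs.continuousOn_slice {E : Type*} [TopologicalSpace E] {k : ℂ → ℝ → E}
    (hk : ContinuousOn (fun q : ℂ × ℝ => k q.1 q.2) (D ×ˢ Set.Icc (0 : ℝ) 1)) (hζ : ζ ∈ D) :
    ContinuousOn (k ζ) (Set.Icc (0 : ℝ) 1) :=
  hk.comp (f := fun t : ℝ => (ζ, t)) (by fun_prop) fun t ht => ⟨hζ, ht⟩

theorem hasDerivAt_exp (h : IsTwistedCycle z A lam D γ y L) (hζ : ζ ∈ D) {t : ℝ}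
    (ht : t ∈ Set.Icc (0 : ℝ) 1) :
    HasDerivAt (fun ζ => Complex.exp (lam * L ζ t)) (dPow lam γ L ζ t) ζ := by
  have hcont : ContinuousOn (fun ζ => L ζ t) D :=
    h.log_continuous.comp (f := fun ζ : ℂ => (ζ, t)) (by fun_prop) fun ζ hζ => ⟨hζ, ht⟩
  have hL := hasDerivAt_of_exp_eq (hcont.continuousAt (h.isOpen.mem_nhds hζ))
    (f := fun ζ => ζ - γ t) (by
      filter_upwards [h.isOpen.mem_nhds hζ] with u hu using h.exp_log u hu t ht)
    ((hasDerivAt_id ζ).sub_const (γ t))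
  rw [one_div] at hL
  exact (hL.const_mul lam).cexp

theorem hasDerivAt_contourIntegral (h : IsTwistedCycle z A lam D γ y L) (hζ : ζ ∈ D)
    (i : Fin r) :
    HasDerivAt (fun ζ => contourIntegral γ y (rlKernel z lam γ L i ζ))
      (contourIntegral γ y (fun t => (γ t - z i)⁻¹ * dPow lam γ L ζ t)) ζ := by
  have hy : ContinuousOn (fun q : ℂ × ℝ => y q.2) (D ×ˢ Set.Icc (0 : ℝ) 1) :=
    h.continuousOn_branch.comp _root_.continuousOn_snd fun _ hq => hq.2
  refine hasDerivAt_integral_smul_of_continuousOn h.isOpen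
    (PiecewiseC1On.intervalIntegrable_deriv h.piecewiseC1)
    (g := fun ζ t => rlKernel z lam γ L i ζ t • y t)
    (g' := fun ζ t => ((γ t - z i)⁻¹ * dPow lam γ L ζ t) • y t)
    ((h.continuousOn_rlKernel i).smul hy) (ContinuousOn.smul (ContinuousOn.mul
      (ContinuousOn.inv₀ (h.continuousOn_snd.sub continuousOn_const) ?_) h.continuousOn_dPow) hy)
    (fun x hx t ht => ?_) hζ
  · exact fun q hq => _root_.sub_ne_zero.mpr (h.avoids _ hq.2 i)
  · exact ((h.hasDerivAt_exp hx ht).const_mul _).smul_const (y t)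

/-- The total derivative of `Y(s) (ζ - s)^lam` integrates to zero over a twisted cycle. -/
theorem sum_mulVec_contourIntegral (h : IsTwistedCycle z A lam D γ y L) (hζ : ζ ∈ D) :
    ∑ i, A i *ᵥ contourIntegral γ y (rlKernel z lam γ L i ζ) =
      contourIntegral γ y (dPow lam γ L ζ) := by
  have hker := fun i => continuousOn_slice (h.continuousOn_rlKernel i) hζ
  have hdPow := continuousOn_slice h.continuousOn_dPow hζ
  have hLζ := continuousOn_slice h.log_continuous hζ
  obtain ⟨s, hs, hγs⟩ := PiecewiseC1On.exists_finite_differentiableAt h.piecewiseC1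
  have hint1 : ∀ i ∈ Finset.univ, IntervalIntegrable
      (fun t => deriv γ t • (rlKernel z lam γ L i ζ t • (A i *ᵥ y t)))
      MeasureTheory.volume 0 1 := by
    intro i _
    refine (PiecewiseC1On.intervalIntegrable_deriv h.piecewiseC1).smul_continuousOn ?_
    rw [Set.uIcc_of_le zero_le_one]
    exact (hker i).smul ((LinearMap.toContinuousLinearMap
      (A i).mulVecLin).continuous.comp_continuousOn h.continuousOn_branch)
  have hint1' : IntervalIntegrable
      (fun t => ∑ i, deriv γ t • (rlKernel z lam γ L i ζ t • (A i *ᵥ y t)))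
      MeasureTheory.volume 0 1 := by
    have := IntervalIntegrable.sum Finset.univ hint1
    simpa only [Finset.sum_fn] using this
  have hint2 := h.intervalIntegrable hdPow
  have hFTC := MeasureTheory.integral_eq_of_hasDerivAt_off_countable_of_le
    (fun t => Complex.exp (lam * L ζ t) • y t)
    (fun t => (∑ i, deriv γ t • (rlKernel z lam γ L i ζ t • (A i *ᵥ y t))) -
      deriv γ t • (dPow lam γ L ζ t • y t)) zero_le_one hs.countable
    (((continuousOn_const.mul hLζ).cexp).smul h.continuousOn_branch) ?_ (hint1'.sub hint2)
  · rw [intervalIntegral.integral_sub hint1' hint2, intervalIntegral.integral_finsetSum hint1,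
      h.returns ζ hζ, sub_self, sub_eq_zero] at hFTC
    simp only [h.mulVec_contourIntegral (hker _)]
    exact hFTC
  · intro t ht
    have htI := Set.Ioo_subset_Icc_self ht.1
    have hnhds : Set.Icc (0 : ℝ) 1 ∈ 𝓝 t := Icc_mem_nhds ht.1.1 ht.1.2
    have hγ := (hγs t ht).hasDerivAt
    have hyd := IsSolutionOn.hasDerivAt h.solution ht.1 hγ
    have hLd := hasDerivAt_of_exp_eq_real (hLζ.continuousAt hnhds) (f := fun t => ζ - γ t)
      (by filter_upwards [hnhds] with u hu using h.exp_log ζ hζ u hu) (hγ.const_sub ζ)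
    have hprod := (hLd.const_mul lam).cexp.smul hyd
    refine hprod.congr_deriv ?_
    refine Eq.trans ?_ (sub_eq_add_neg _ _).symm
    congr 1
    · rw [Finset.smul_sum, Finset.smul_sum]
      refine Finset.sum_congr rfl fun i _ => ?_
      simp only [smul_smul, rlKernel]
      congr 1
      ring
    · rw [smul_smul, ← neg_smul]
      congr 1
      rw [dPow]
      ring

/-- The vector of all the integrals satisfies the system with residues `G_i`, already before the
passage to the quotient. -/
theorem hasDerivAt_rlVector (h : IsTwistedCycle z A lam D γ y L) (hζ : ζ ∈ D) :
    HasDerivAt (rlVector z lam γ y L)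
      (∑ i, (ζ - z i)⁻¹ • (convMat A lam i *ᵥ rlVector z lam γ y L ζ)) ζ := by
  rw [hasDerivAt_pi]
  rintro ⟨j, k⟩
  have hd := hasDerivAt_pi.mp (h.hasDerivAt_contourIntegral hζ j) k
  refine hd.congr_deriv ?_
  have hj : ζ - z j ≠ 0 := _root_.sub_ne_zero.mpr fun hzj => h.not_mem j (hzj ▸ hζ)
  -- `(ζ - z) / ((s - z) (ζ - s)) = 1 / (s - z) + 1 / (ζ - s)`
  have key : (ζ - z j) • contourIntegral γ y (fun t => (γ t - z j)⁻¹ * dPow lam γ L ζ t) =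
      (∑ i, A i *ᵥ contourIntegral γ y (rlKernel z lam γ L i ζ)) +
        lam • contourIntegral γ y (rlKernel z lam γ L j ζ) := by
    rw [h.sum_mulVec_contourIntegral hζ, ← contourIntegral_const_mul, ← contourIntegral_const_mul,
      ← h.contourIntegral_add (ψ := fun t => lam * rlKernel z lam γ L j ζ t)
        (continuousOn_slice h.continuousOn_dPow hζ)
        (continuousOn_const.mul (continuousOn_slice (h.continuousOn_rlKernel j) hζ))]
    refine contourIntegral_congr fun t ht => ?_
    have h1 : γ t - z j ≠ 0 := _root_.sub_ne_zero.mpr (h.avoids t ht j)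
    have h2 := h.sub_ne_zero hζ ht
    simp only [dPow, rlKernel]
    field_simp
    ring
  have hblock : block j (∑ i, (ζ - z i)⁻¹ • (convMat A lam i *ᵥ rlVector z lam γ y L ζ)) =
      (ζ - z j)⁻¹ • ((∑ i, A i *ᵥ contourIntegral γ y (rlKernel z lam γ L i ζ)) +
        lam • contourIntegral γ y (rlKernel z lam γ L j ζ)) := by
    rw [map_sum, Finset.sum_eq_single j]
    · rw [map_smul, block_convMat_mulVec, if_pos rfl]
      rfl
    · intro i _ hi
      rw [map_smul, block_convMat_mulVec, if_neg (Ne.symm hi), smul_zero]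
    · simp
  rw [← key, inv_smul_smul₀ hj] at hblock
  exact congrFun hblock.symm k

theorem riemannLiouville_eq (h : IsTwistedCycle z A lam D γ y L) (hζ : ζ ∈ D) {n' : ℕ}
    (P : Matrix (Fin n') (Fin r × Fin n) ℂ) :
    riemannLiouville z P lam γ y L ζ = P *ᵥ rlVector z lam γ y L ζ := by
  have hP : P *ᵥ rlVector z lam γ y L ζ = ∑ i, P.submatrix id (fun k : Fin n => (i, k)) *ᵥ
      contourIntegral γ y (rlKernel z lam γ L i ζ) := by
    ext p
    simp only [Matrix.mulVec, dotProduct, Fintype.sum_prod_type, Finset.sum_apply,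
      Matrix.submatrix_apply, id]
    rfl
  rw [hP]
  refine Finset.sum_congr rfl fun i _ => ?_
  rw [h.mulVec_contourIntegral (continuousOn_slice (h.continuousOn_rlKernel i) hζ)]
  refine intervalIntegral.integral_congr fun t _ => ?_
  simp only [smul_smul, rlKernel]
  congr 1
  ring

theorem solvesAt_riemannLiouville (h : IsTwistedCycle z A lam D γ y L) (hζ : ζ ∈ D) {n' : ℕ}
    {P : Matrix (Fin n') (Fin r × Fin n) ℂ} {A' : Fin r → Matrix (Fin n') (Fin n') ℂ}
    (hP : IsMiddleConvolution A lam P A') :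
    SolvesAt z A' (riemannLiouville z P lam γ y L) ζ := by
  have hd := (LinearMap.toContinuousLinearMap P.mulVecLin).hasFDerivAt.comp_hasDerivAt ζ
    (h.hasDerivAt_rlVector hζ)
  have hd' := hd.congr_of_eventuallyEq (f₁ := riemannLiouville z P lam γ y L) (by
    filter_upwards [h.isOpen.mem_nhds hζ] with x hx using h.riemannLiouville_eq hx P)
  refine hd'.congr_deriv ?_
  rw [h.riemannLiouville_eq hζ]
  simp only [LinearMap.coe_toContinuousLinearMap', map_sum, map_smul, Matrix.mulVecLin_apply,
    Matrix.mulVec_mulVec, hP.intertwines]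

end IsTwistedCycle

/-! ### Linear differential equations in a complex disc -/

section LinearODE

variable {E : Type*} [NormedAddCommGroup E] [NormedSpace ℂ E]

theorem hasDerivAt_comp_segment {f : ℂ → E} {f' : E} {p x : ℂ} {s : ℝ}
    (hf : HasDerivAt f f' (p + s * (x - p))) :
    HasDerivAt (fun s : ℝ => f (p + s * (x - p))) ((x - p) • f') s := by
  have h1 : HasDerivAt (fun s : ℝ => p + (s : ℂ) * (x - p)) (x - p) s := by
    simpa using ((Complex.ofRealCLM.hasDerivAt (x := s)).mul_const (x - p)).const_add p
  exact HasDerivAt.scomp s hf h1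

theorem segment_mem_ball {c p x : ℂ} {r s : ℝ} (hp : p ∈ Metric.ball c r)
    (hx : x ∈ Metric.ball c r) (hs : s ∈ Set.Icc (0 : ℝ) 1) :
    p + s * (x - p) ∈ Metric.ball c r := by
  simpa using (convex_ball c r).add_smul_sub_mem hp hx hs

theorem norm_le_of_norm_deriv_le_pow {f f' : ℂ → E} {c p : ℂ} {r a : ℝ} {k : ℕ}
    (hp : p ∈ Metric.ball c r) (hf : ∀ x ∈ Metric.ball c r, HasDerivAt f (f' x) x)
    (hfp : f p = 0) (hf' : ∀ x ∈ Metric.ball c r, ‖f' x‖ ≤ a * ‖x - p‖ ^ k)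
    {x : ℂ} (hx : x ∈ Metric.ball c r) : ‖f x‖ ≤ a * ‖x - p‖ ^ (k + 1) / (k + 1) := by
  have hder : ∀ s ∈ Set.Icc (0 : ℝ) 1, HasDerivAt (fun s : ℝ => f (p + s * (x - p)))
      ((x - p) • f' (p + s * (x - p))) s := fun s hs =>
    hasDerivAt_comp_segment (hf _ (segment_mem_ball hp hx hs))
  have hB : ∀ s : ℝ, HasDerivAt (fun s : ℝ => a * ‖x - p‖ ^ (k + 1) / (k + 1) * s ^ (k + 1))
      (a * ‖x - p‖ ^ (k + 1) * s ^ k) s := fun s => by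
    have h := (hasDerivAt_pow (k + 1) s).const_mul (a * ‖x - p‖ ^ (k + 1) / (k + 1))
    refine h.congr_deriv ?_
    have : (k : ℝ) + 1 ≠ 0 := by positivity
    push_cast
    field_simp
  have := image_norm_le_of_norm_deriv_right_le_deriv_boundary (a := 0) (b := 1)
    (HasDerivAt.continuousOn hder)
    (fun s hs => (hder s (Set.Ico_subset_Icc_self hs)).hasDerivWithinAt) (by simp [hfp])
    hB (fun s hs => ?_) (Set.right_mem_Icc.mpr zero_le_one)
  · simpa using this
  · rw [norm_smul]
    refine (mul_le_mul_of_nonneg_left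
      (hf' _ (segment_mem_ball hp hx (Set.Ico_subset_Icc_self hs))) (norm_nonneg _)).trans_eq ?_
    rw [add_sub_cancel_left, norm_mul, Complex.norm_real, Real.norm_of_nonneg hs.1]
    ring

/-- Existence of holomorphic solutions of `F' = B F` on a disc, as the sum of the Picard series
whose terms are the iterated primitives `g_{k+1}' = B g_k`, `g_0 = v`. -/
theorem exists_hasDerivAt_clm_apply [CompleteSpace E] {B : ℂ → E →L[ℂ] E} {c p : ℂ} {r M : ℝ}
    (hp : p ∈ Metric.ball c r) (hB : DifferentiableOn ℂ B (Metric.ball c r))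
    (hM : ∀ x ∈ Metric.ball c r, ‖B x‖ ≤ M) (v : E) :
    ∃ F : ℂ → E, F p = v ∧ ∀ x ∈ Metric.ball c r, HasDerivAt F (B x (F x)) x := by
  have hprim : ∀ f : ℂ → E, ∃ g : ℂ → E, DifferentiableOn ℂ f (Metric.ball c r) →
      g p = 0 ∧ ∀ x ∈ Metric.ball c r, HasDerivAt g (B x (f x)) x := by
    intro f
    by_cases hf : DifferentiableOn ℂ f (Metric.ball c r)
    · obtain ⟨g, hg⟩ := (hB.clm_apply hf).isExactOn_ball.with_val_at p 0
      exact ⟨g, fun _ => hg⟩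
    · exact ⟨0, fun h => absurd h hf⟩
  choose S hS using hprim
  let g : ℕ → ℂ → E := fun k => Nat.rec (fun _ => v) (fun _ f => S f) k
  have hgd : ∀ k, DifferentiableOn ℂ (g k) (Metric.ball c r) := by
    intro k
    induction k with
    | zero => exact differentiableOn_const v
    | succ k ih => exact fun x hx => ((hS _ ih).2 x hx).differentiableAt.differentiableWithinAt
  have hg0 : ∀ k, g (k + 1) p = 0 := fun k => (hS _ (hgd k)).1
  have hg' : ∀ k, ∀ x ∈ Metric.ball c r, HasDerivAt (g (k + 1)) (B x (g k x)) x :=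
    fun k => (hS _ (hgd k)).2
  have hM0 : 0 ≤ M := (norm_nonneg _).trans (hM p hp)
  have hbound : ∀ k, ∀ x ∈ Metric.ball c r,
      ‖g k x‖ ≤ ‖v‖ * M ^ k / k.factorial * ‖x - p‖ ^ k := by
    intro k
    induction k with
    | zero => intro x _; simp [g]
    | succ k ih =>
      intro x hx
      refine (norm_le_of_norm_deriv_le_pow (k := k) (a := ‖v‖ * M ^ (k + 1) / k.factorial) hp (hg' k)
        (hg0 k) (fun u hu => ?_) hx).trans_eq ?_
      · calc ‖B u (g k u)‖ ≤ ‖B u‖ * ‖g k u‖ := (B u).le_opNorm _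
          _ ≤ M * (‖v‖ * M ^ k / k.factorial * ‖u - p‖ ^ k) :=
            mul_le_mul (hM u hu) (ih u hu) (norm_nonneg _) hM0
          _ = _ := by ring
      · rw [Nat.factorial_succ]
        push_cast
        field_simp
  have hdist : ∀ x ∈ Metric.ball c r, ‖x - p‖ ≤ 2 * r := fun x hx => by
    rw [← dist_eq_norm]
    have h1 := dist_triangle_right x p c
    have h2 := Metric.mem_ball.mp hx
    have h3 := Metric.mem_ball.mp hp
    linarith
  have hu : Summable fun k : ℕ => ‖v‖ * ((M * (2 * r)) ^ k / k.factorial) :=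
    (Real.summable_pow_div_factorial (M * (2 * r))).mul_left _
  have hgu : ∀ k, ∀ x ∈ Metric.ball c r,
      ‖g k x‖ ≤ ‖v‖ * ((M * (2 * r)) ^ k / k.factorial) := fun k x hx => by
    refine (hbound k x hx).trans ?_
    have : ‖x - p‖ ^ k ≤ (2 * r) ^ k := pow_le_pow_left₀ (norm_nonneg _) (hdist x hx) k
    calc ‖v‖ * M ^ k / k.factorial * ‖x - p‖ ^ k
        ≤ ‖v‖ * M ^ k / k.factorial * (2 * r) ^ k := by gcongr
      _ = _ := by rw [mul_pow]; ring
  refine ⟨fun x => v + ∑' k, g (k + 1) x, by simp [hg0], fun x hx => ?_⟩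
  have hsum : Summable fun k => g k x := Summable.of_norm_bounded hu fun k => hgu k x hx
  have hFx : v + ∑' k, g (k + 1) x = ∑' k, g k x := hsum.tsum_eq_zero_add.symm
  have hder := hasDerivAt_tsum_of_isPreconnected (hu.mul_left M) Metric.isOpen_ball
    (convex_ball c r).isPreconnected hg' (fun k y hy => ((B y).le_opNorm _).trans
      (mul_le_mul (hM y hy) (hgu k y hy) (norm_nonneg _) hM0)) hp (by simp [hg0]) hx
  change HasDerivAt _ (B x (v + ∑' k, g (k + 1) x)) x
  rw [hFx, (B x).map_tsum hsum]
  exact hder.const_add v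

/-- Uniqueness of holomorphic solutions of `F' = B F`, by Grönwall's inequality on segments. -/
theorem eventuallyEq_of_hasDerivAt_clm_apply {B : ℂ → E →L[ℂ] E} {F G : ℂ → E} {p : ℂ}
    (hB : ContinuousAt B p) (hF : ∀ᶠ x in 𝓝 p, HasDerivAt F (B x (F x)) x)
    (hG : ∀ᶠ x in 𝓝 p, HasDerivAt G (B x (G x)) x) (h : F p = G p) : F =ᶠ[𝓝 p] G := by
  have hM : ∀ᶠ x in 𝓝 p, ‖B x‖ < ‖B p‖ + 1 := hB.norm.eventually_lt_const (by linarith)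
  obtain ⟨r, hr, hball⟩ := Metric.eventually_nhds_iff_ball.mp (hF.and (hG.and hM))
  filter_upwards [Metric.ball_mem_nhds p hr] with x hx
  have hp := Metric.mem_ball_self (x := p) hr
  have hder : ∀ s ∈ Set.Icc (0 : ℝ) 1,
      HasDerivAt (fun s : ℝ => (F - G) (p + s * (x - p)))
        ((x - p) • B (p + s * (x - p)) ((F - G) (p + s * (x - p)))) s := by
    intro s hs
    obtain ⟨h1, h2, -⟩ := hball _ (segment_mem_ball hp hx hs)
    refine hasDerivAt_comp_segment ((h1.sub h2).congr_deriv ?_)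
    rw [Pi.sub_apply, map_sub]
  have := eq_zero_of_abs_deriv_le_mul_abs_self_of_eq_zero_right
    (K := ‖x - p‖ * (‖B p‖ + 1)) (HasDerivAt.continuousOn hder)
    (fun s hs => (hder s (Set.Ico_subset_Icc_self hs)).hasDerivWithinAt) (by simp [h])
    (fun s hs => ?_) 1 (Set.right_mem_Icc.mpr zero_le_one)
  · simpa [sub_eq_zero] using this
  · obtain ⟨-, -, h3⟩ := hball _ (segment_mem_ball hp hx (Set.Ico_subset_Icc_self hs))
    rw [norm_smul, mul_assoc]
    exact mul_le_mul_of_nonneg_left (((B _).le_opNorm _).trans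
      (mul_le_mul_of_nonneg_right h3.le (norm_nonneg _))) (norm_nonneg _)

end LinearODE

/-! ### Continuation of solutions of a Fuchsian system -/

section Continuation

variable {n r : ℕ} {z : Fin r → ℂ} {A : Fin r → Matrix (Fin n) (Fin n) ℂ}
  {γ δ : ℝ → ℂ} {y x : ℝ → Fin n → ℂ} {a b c : ℝ}

/-- The coefficient `∑_i A_i/(x - z_i)` of a Fuchsian system. -/
def coeff (z : Fin r → ℂ) (A : Fin r → Matrix (Fin n) (Fin n) ℂ) (x : ℂ) :
    (Fin n → ℂ) →L[ℂ] (Fin n → ℂ) :=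
  ∑ i, (x - z i)⁻¹ • LinearMap.toContinuousLinearMap (A i).mulVecLin

theorem solvesAt_iff {F : ℂ → Fin n → ℂ} {x : ℂ} :
    SolvesAt z A F x ↔ HasDerivAt F (coeff z A x (F x)) x := by
  simp [SolvesAt, coeff]

theorem differentiableAt_coeff {x : ℂ} (hx : ∀ i, x ≠ z i) :
    DifferentiableAt ℂ (coeff z A) x := by
  unfold coeff
  refine DifferentiableAt.fun_sum fun i _ => DifferentiableAt.smul_const ?_ _
  exact (differentiableAt_id.sub_const (z i)).inv (sub_ne_zero.mpr (hx i))

theorem exists_solvesAt_ball {c p : ℂ} {ρ ρ' : ℝ} (hρ : ρ' < ρ)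
    (hz : ∀ i, z i ∉ Metric.ball c ρ) (hp : p ∈ Metric.ball c ρ') (v : Fin n → ℂ) :
    ∃ F : ℂ → Fin n → ℂ, F p = v ∧ ∀ x ∈ Metric.ball c ρ', SolvesAt z A F x := by
  have hd : ∀ x ∈ Metric.closedBall c ρ', DifferentiableAt ℂ (coeff z A) x := fun x hx =>
    differentiableAt_coeff fun i hxz => hz i (hxz ▸ Metric.closedBall_subset_ball hρ hx)
  obtain ⟨M, hM⟩ := (isCompact_closedBall c ρ').exists_bound_of_continuousOn
    fun x hx => (hd x hx).continuousAt.continuousWithinAt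
  simp only [solvesAt_iff]
  exact exists_hasDerivAt_clm_apply hp
    (fun x hx => (hd x (Metric.ball_subset_closedBall hx)).differentiableWithinAt)
    (fun x hx => hM x (Metric.ball_subset_closedBall hx)) v

theorem eventuallyEq_of_solvesAt {F G : ℂ → Fin n → ℂ} {p : ℂ} (hp : ∀ i, p ≠ z i)
    (hF : ∀ᶠ x in 𝓝 p, SolvesAt z A F x) (hG : ∀ᶠ x in 𝓝 p, SolvesAt z A G x)
    (h : F p = G p) : F =ᶠ[𝓝 p] G := by
  simp only [solvesAt_iff] at hF hG
  exact eventuallyEq_of_hasDerivAt_clm_apply (differentiableAt_coeff hp).continuousAt hF hG h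

theorem IsSolutionOn.congr (h : IsSolutionOn z A γ y a b) (hγ : Set.EqOn δ γ (Set.Icc a b))
    (hy : Set.EqOn x y (Set.Icc a b)) : IsSolutionOn z A δ x a b := by
  intro t ht
  obtain ⟨F, hF, hyF⟩ := h t ht
  refine ⟨F, by rwa [hγ ht], ?_⟩
  filter_upwards [hyF, self_mem_nhdsWithin] with u hu hut
  rw [hy hut, hu, hγ hut]

theorem IsSolutionOn.comp (h : IsSolutionOn z A γ y a b) {φ : ℝ → ℝ} (hφ : Continuous φ)
    {a' b' : ℝ} (hmaps : Set.MapsTo φ (Set.Icc a' b') (Set.Icc a b)) :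
    IsSolutionOn z A (fun t => γ (φ t)) (fun t => y (φ t)) a' b' := by
  intro t ht
  obtain ⟨F, hF, hyF⟩ := h (φ t) (hmaps ht)
  exact ⟨F, hF, (hφ.continuousWithinAt.tendsto_nhdsWithin hmaps).eventually hyF⟩

theorem isSolutionOn_comp {F : ℂ → Fin n → ℂ} {U : Set ℂ} (hU : IsOpen U)
    (hF : ∀ x ∈ U, SolvesAt z A F x) (hγ : Set.MapsTo γ (Set.Icc a b) U) :
    IsSolutionOn z A γ (fun t => F (γ t)) a b := fun t ht =>
  ⟨F, by filter_upwards [hU.mem_nhds (hγ ht)] with x hx using hF x hx,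
    Filter.Eventually.of_forall fun _ => rfl⟩

theorem IsSolutionOn.trans (h₁ : IsSolutionOn z A γ y a b) (h₂ : IsSolutionOn z A γ y b c)
    (hab : a ≤ b) (hbc : b ≤ c) (hγ : ContinuousOn γ (Set.Icc a c)) (hz : ∀ i, γ b ≠ z i) :
    IsSolutionOn z A γ y a c := by
  intro t ht
  rw [← Set.Icc_union_Icc_eq_Icc hab hbc]
  have hbot : ∀ {S : Set ℝ}, IsClosed S → t ∉ S → 𝓝[S] t = ⊥ := fun hS ht => by
    rw [← notMem_closure_iff_nhdsWithin_eq_bot, hS.closure_eq]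
    exact ht
  rcases lt_trichotomy t b with hlt | rfl | hlt
  · obtain ⟨F, hF, hyF⟩ := h₁ t ⟨ht.1, hlt.le⟩
    refine ⟨F, hF, ?_⟩
    rwa [nhdsWithin_union, hbot isClosed_Icc fun h => absurd h.1 (not_le.mpr hlt), sup_bot_eq]
  · obtain ⟨F, hF, hyF⟩ := h₁ t ⟨hab, le_rfl⟩
    obtain ⟨G, hG, hyG⟩ := h₂ t ⟨le_rfl, hbc⟩
    have hFG : F =ᶠ[𝓝 (γ t)] G := eventuallyEq_of_solvesAt hz hF hG <| by
      rw [← hyF.self_of_nhdsWithin ⟨hab, le_rfl⟩, hyG.self_of_nhdsWithin ⟨le_rfl, hbc⟩]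
    refine ⟨F, hF, ?_⟩
    rw [nhdsWithin_union, Filter.eventually_sup]
    refine ⟨hyF, ?_⟩
    have hγt : Filter.Tendsto γ (𝓝[Set.Icc t c] t) (𝓝 (γ t)) :=
      (hγ t ht).mono (Set.Icc_subset_Icc_left hab)
    filter_upwards [hyG, hγt.eventually hFG] with u hu hu'
    rw [hu, hu']
  · obtain ⟨F, hF, hyF⟩ := h₂ t ⟨hlt.le, ht.2⟩
    refine ⟨F, hF, ?_⟩
    rwa [nhdsWithin_union, hbot isClosed_Icc fun h => absurd h.2 (not_le.mpr hlt), bot_sup_eq]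

/-- Solutions of a Fuchsian system can be continued along every path that avoids the poles. -/
theorem exists_isSolutionOn (hγ : ContinuousOn γ (Set.Icc (0 : ℝ) 1))
    (hz : ∀ t ∈ Set.Icc (0 : ℝ) 1, ∀ i, γ t ≠ z i) (v : Fin n → ℂ) :
    ∃ y : ℝ → Fin n → ℂ, IsSolutionOn z A γ y 0 1 ∧ y 0 = v := by
  -- All discs of radius `d` around points of the path are free of poles.
  obtain ⟨d, hd, hdz⟩ : ∃ d > 0, ∀ t ∈ Set.Icc (0 : ℝ) 1, ∀ i, z i ∉ Metric.ball (γ t) d := by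
    have hdisj : Disjoint (γ '' Set.Icc (0 : ℝ) 1) (Set.range z) := by
      rw [Set.disjoint_left]
      rintro _ ⟨t, ht, rfl⟩ ⟨i, hi⟩
      exact hz t ht i hi.symm
    obtain ⟨d, hd, hsep⟩ := hdisj.exists_thickenings (isCompact_Icc.image_of_continuousOn hγ)
      (Set.finite_range z).isClosed
    refine ⟨d, hd, fun t ht i hi => ?_⟩
    refine Set.disjoint_left.mp hsep (Metric.mem_thickening_iff.mpr
      ⟨γ t, Set.mem_image_of_mem γ ht, hi⟩) (Metric.self_subset_thickening hd _ ⟨i, rfl⟩)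
  obtain ⟨η, hη, hηd⟩ := Metric.uniformContinuousOn_iff.mp
    (isCompact_Icc.uniformContinuousOn_of_continuous hγ) (d / 2) (half_pos hd)
  have step : ∀ T T' : ℝ, 0 ≤ T → T ≤ T' → T' ≤ 1 → T' - T < η →
      (∃ y : ℝ → Fin n → ℂ, IsSolutionOn z A γ y 0 T ∧ y 0 = v) →
      ∃ y : ℝ → Fin n → ℂ, IsSolutionOn z A γ y 0 T' ∧ y 0 = v := by
    rintro T T' h0 hT hT' hlt ⟨y, hy, hy0⟩
    have hTI : T ∈ Set.Icc (0 : ℝ) 1 := ⟨h0, hT.trans hT'⟩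
    obtain ⟨F, hFT, hF⟩ := exists_solvesAt_ball (A := A) (half_lt_self hd) (hdz T hTI)
      (Metric.mem_ball_self (half_pos hd)) (y T)
    refine ⟨fun t => if t ≤ T then y t else F (γ t), ?_, by simp [h0, hy0]⟩
    refine IsSolutionOn.trans (b := T) (hy.congr (fun _ _ => rfl) fun t ht => if_pos ht.2)
      ((isSolutionOn_comp Metric.isOpen_ball hF fun t ht => ?_).congr (fun _ _ => rfl)
        fun t ht => ?_) h0 hT (hγ.mono (Set.Icc_subset_Icc_right hT')) (hz T hTI)
    · refine hηd t ⟨h0.trans ht.1, ht.2.trans hT'⟩ T hTI ?_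
      rw [Real.dist_eq, abs_of_nonneg (sub_nonneg.mpr ht.1)]
      linarith [ht.2]
    · rcases ht.1.eq_or_lt with rfl | hlt'
      · simp [hFT]
      · simp [not_le.mpr hlt']
  have hall : ∀ k : ℕ, ∃ y : ℝ → Fin n → ℂ, IsSolutionOn z A γ y 0 (min 1 (k * (η / 2))) ∧
      y 0 = v := by
    intro k
    induction k with
    | zero =>
      obtain ⟨F, hF0, hF⟩ := exists_solvesAt_ball (A := A) (half_lt_self hd)
        (hdz 0 ⟨le_rfl, zero_le_one⟩) (Metric.mem_ball_self (half_pos hd)) v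
      refine ⟨fun t => F (γ t), isSolutionOn_comp Metric.isOpen_ball hF fun t ht => ?_, hF0⟩
      have : t = 0 := le_antisymm (by simpa using ht.2) ht.1
      rw [this]
      exact Metric.mem_ball_self (half_pos hd)
    | succ k ih =>
      refine step _ _ (by positivity) (min_le_min_left _ ?_) (min_le_left _ _) ?_ ih
      · push_cast
        nlinarith
      · push_cast
        rcases le_total 1 ((k : ℝ) * (η / 2)) with h | h
        · rw [min_eq_left h]
          linarith [min_le_left 1 (((k : ℝ) + 1) * (η / 2))]
        · rw [min_eq_right h]
          linarith [min_le_right 1 (((k : ℝ) + 1) * (η / 2))]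
  obtain ⟨k, hk⟩ := exists_nat_gt (1 / (η / 2))
  have := hall k
  rwa [min_eq_left ((div_lt_iff₀ (half_pos hη)).mp hk).le] at this

end Continuation

/-! ### Pochhammer contours -/

theorem PiecewiseC1On.congr {γ δ : ℝ → ℂ} {a b : ℝ} (h : PiecewiseC1On γ a b)
    (hδ : Set.EqOn δ γ (Set.Icc a b)) : PiecewiseC1On δ a b := by
  obtain ⟨N, t, ht, rfl, rfl, hC⟩ := h
  exact ⟨N, t, ht, rfl, rfl, fun k hk => (hC k hk).congr fun x hx =>
    hδ ⟨(ht (Nat.zero_le k)).trans hx.1, hx.2.trans (ht hk)⟩⟩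

theorem PiecewiseC1On.trans {γ : ℝ → ℂ} {a b c : ℝ} (h₁ : PiecewiseC1On γ a b)
    (h₂ : PiecewiseC1On γ b c) : PiecewiseC1On γ a c := by
  obtain ⟨N, t, ht, rfl, rfl, hC⟩ := h₁
  obtain ⟨N', t', ht', h0, rfl, hC'⟩ := h₂
  refine ⟨N + N', fun k => if k ≤ N then t k else t' (k - N), ?_, by simp, ?_, fun k hk => ?_⟩
  · refine monotone_nat_of_le_succ fun k => ?_
    rcases lt_trichotomy k N with hk | rfl | hk
    · simp only [hk.le, Nat.succ_le_of_lt hk, if_true]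
      exact ht (Nat.le_succ k)
    · simp only [le_refl, if_true, Nat.not_succ_le_self, if_false, ← h0]
      exact ht' (Nat.zero_le _)
    · simp only [not_le.mpr hk, not_le.mpr (hk.trans (Nat.lt_succ_self k)), if_false]
      exact ht' (by omega)
  · rcases Nat.eq_zero_or_pos N' with rfl | hN
    · simp [h0]
    · simp [show N' ≠ 0 by omega]
  · rcases lt_trichotomy k N with hkN | rfl | hkN
    · simp only [hkN.le, Nat.succ_le_of_lt hkN, if_true]
      exact hC k hkN
    · simp only [le_refl, if_true, Nat.not_succ_le_self, if_false, ← h0, Nat.add_sub_cancel_left]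
      exact hC' 0 (by omega)
    · simp only [not_le.mpr hkN, not_le.mpr (hkN.trans (Nat.lt_succ_self k)), if_false,
        Nat.sub_add_comm hkN.le]
      exact hC' (k - N) (by omega)

theorem PiecewiseC1On.comp_mul_add {γ : ℝ → ℂ} {p q a b : ℝ} (hp : 0 < p)
    (h : PiecewiseC1On γ (p * a + q) (p * b + q)) :
    PiecewiseC1On (fun t => γ (p * t + q)) a b := by
  obtain ⟨N, t, ht, h0, hN, hC⟩ := h
  refine ⟨N, fun k => (t k - q) / p, fun i j hij => ?_, ?_, ?_, fun k hk => ?_⟩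
  · exact div_le_div_of_nonneg_right (sub_le_sub_right (ht hij) q) hp.le
  · simp only [h0]; field_simp; ring
  · simp only [hN]; field_simp; ring
  · refine (hC k hk).comp (f := fun t : ℝ => p * t + q) (by fun_prop) fun x hx => ?_
    have h1 := (div_le_iff₀ hp).mp hx.1
    have h2 := (le_div_iff₀ hp).mp hx.2
    constructor <;> linarith

theorem PiecewiseC1On.comp_sub_mul {γ : ℝ → ℂ} {p q a b : ℝ} (hp : 0 < p)
    (h : PiecewiseC1On γ (q - p * b) (q - p * a)) :
    PiecewiseC1On (fun t => γ (q - p * t)) a b := by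
  obtain ⟨N, t, ht, h0, hN, hC⟩ := h
  refine ⟨N, fun k => (q - t (N - k)) / p, fun i j hij => ?_, ?_, ?_, fun k hk => ?_⟩
  · exact div_le_div_of_nonneg_right (sub_le_sub_left (ht (by omega)) q) hp.le
  · simp only [Nat.sub_zero, hN]; field_simp; ring
  · simp only [Nat.sub_self, h0]; field_simp; ring
  · have hk' : N - k = (N - (k + 1)) + 1 := by omega
    refine (hC (N - (k + 1)) (by omega)).comp (f := fun t : ℝ => q - p * t) (by fun_prop)
      fun x hx => ?_
    simp only [hk'] at hx
    have h1 := (div_le_iff₀ hp).mp hx.1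
    have h2 := (le_div_iff₀ hp).mp hx.2
    constructor <;> linarith

/-- Four functions on `[0, 1]`, run through one after the other on the four quarters of `[0, 1]`,
the last two of them backwards. -/
def concat {X : Type*} (f₁ f₂ f₃ f₄ : ℝ → X) (t : ℝ) : X :=
  if t ≤ 1 / 4 then f₁ (4 * t)
  else if t ≤ 1 / 2 then f₂ (4 * t - 1)
  else if t ≤ 3 / 4 then f₃ (3 - 4 * t)
  else f₄ (4 - 4 * t)

section Concat

variable {X : Type*} {f₁ f₂ f₃ f₄ : ℝ → X}

theorem concat_eqOn₁ :
    Set.EqOn (concat f₁ f₂ f₃ f₄) (fun t => f₁ (4 * t + 0)) (Set.Icc 0 (1 / 4)) := by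
  intro t ht
  simp only [concat, ht.2, if_true, add_zero]

theorem concat_eqOn₂ (h₁ : f₁ 1 = f₂ 0) :
    Set.EqOn (concat f₁ f₂ f₃ f₄) (fun t => f₂ (4 * t + -1)) (Set.Icc (1 / 4) (1 / 2)) := by
  intro t ht
  rcases ht.1.eq_or_lt with rfl | h
  · norm_num [concat, h₁]
  · simp only [concat, not_le.mpr h, ht.2, if_true, if_false, sub_eq_add_neg]

theorem concat_eqOn₃ (h₂ : f₂ 1 = f₃ 1) :
    Set.EqOn (concat f₁ f₂ f₃ f₄) (fun t => f₃ (3 - 4 * t)) (Set.Icc (1 / 2) (3 / 4)) := by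
  intro t ht
  have h0 : ¬ t ≤ 1 / 4 := by linarith [ht.1]
  rcases ht.1.eq_or_lt with rfl | h
  · norm_num [concat, h₂]
  · simp only [concat, h0, not_le.mpr h, ht.2, if_true, if_false]

theorem concat_eqOn₄ (h₃ : f₃ 0 = f₄ 1) :
    Set.EqOn (concat f₁ f₂ f₃ f₄) (fun t => f₄ (4 - 4 * t)) (Set.Icc (3 / 4) 1) := by
  intro t ht
  have h0 : ¬ t ≤ 1 / 4 := by linarith [ht.1]
  have h1 : ¬ t ≤ 1 / 2 := by linarith [ht.1]
  rcases ht.1.eq_or_lt with rfl | h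
  · norm_num [concat, h₃]
  · simp only [concat, h0, h1, not_le.mpr h, if_false]

theorem concat_zero : concat f₁ f₂ f₃ f₄ 0 = f₁ 0 := by norm_num [concat]

theorem concat_one : concat f₁ f₂ f₃ f₄ 1 = f₄ 0 := by norm_num [concat]

theorem concat_forall₂ {Y : Type*} {g₁ g₂ g₃ g₄ : ℝ → Y} {R : X → Y → Prop}
    (h₁ : ∀ t ∈ Set.Icc (0 : ℝ) 1, R (f₁ t) (g₁ t)) (h₂ : ∀ t ∈ Set.Icc (0 : ℝ) 1, R (f₂ t) (g₂ t))
    (h₃ : ∀ t ∈ Set.Icc (0 : ℝ) 1, R (f₃ t) (g₃ t)) (h₄ : ∀ t ∈ Set.Icc (0 : ℝ) 1, R (f₄ t) (g₄ t))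
    {t : ℝ} (ht : t ∈ Set.Icc (0 : ℝ) 1) : R (concat f₁ f₂ f₃ f₄ t) (concat g₁ g₂ g₃ g₄ t) := by
  obtain ⟨ht0, ht1⟩ := ht
  unfold concat
  split_ifs with c1 c2 c3
  · exact h₁ _ ⟨by linarith, by linarith⟩
  · exact h₂ _ ⟨by linarith, by linarith⟩
  · exact h₃ _ ⟨by linarith, by linarith⟩
  · exact h₄ _ ⟨by linarith, by linarith⟩

theorem mapsTo_mul_add (q : ℝ) {a b : ℝ} (ha : 0 ≤ 4 * a + q) (hb : 4 * b + q ≤ 1) :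
    Set.MapsTo (fun t : ℝ => 4 * t + q) (Set.Icc a b) (Set.Icc 0 1) := fun t ht =>
  ⟨by linarith [ht.1], by linarith [ht.2]⟩

theorem mapsTo_sub_mul (q : ℝ) {a b : ℝ} (ha : 0 ≤ q - 4 * b) (hb : q - 4 * a ≤ 1) :
    Set.MapsTo (fun t : ℝ => q - 4 * t) (Set.Icc a b) (Set.Icc 0 1) := fun t ht =>
  ⟨by linarith [ht.2], by linarith [ht.1]⟩

theorem continuousOn_concat [TopologicalSpace X] (h₁ : f₁ 1 = f₂ 0) (h₂ : f₂ 1 = f₃ 1)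
    (h₃ : f₃ 0 = f₄ 1) (hf₁ : ContinuousOn f₁ (Set.Icc 0 1)) (hf₂ : ContinuousOn f₂ (Set.Icc 0 1))
    (hf₃ : ContinuousOn f₃ (Set.Icc 0 1)) (hf₄ : ContinuousOn f₄ (Set.Icc 0 1)) :
    ContinuousOn (concat f₁ f₂ f₃ f₄) (Set.Icc 0 1) := by
  have c₁ := (hf₁.comp (f := fun t : ℝ => 4 * t + 0) (by fun_prop)
    (mapsTo_mul_add 0 (a := 0) (b := 1 / 4) (by norm_num) (by norm_num))).congr
    (concat_eqOn₁ (f₂ := f₂) (f₃ := f₃) (f₄ := f₄))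
  have c₂ := (hf₂.comp (f := fun t : ℝ => 4 * t + -1) (by fun_prop)
    (mapsTo_mul_add (-1) (a := 1 / 4) (b := 1 / 2) (by norm_num) (by norm_num))).congr
    (concat_eqOn₂ (f₃ := f₃) (f₄ := f₄) h₁)
  have c₃ := (hf₃.comp (f := fun t : ℝ => 3 - 4 * t) (by fun_prop)
    (mapsTo_sub_mul 3 (a := 1 / 2) (b := 3 / 4) (by norm_num) (by norm_num))).congr
    (concat_eqOn₃ (f₁ := f₁) (f₄ := f₄) h₂)
  have c₄ := (hf₄.comp (f := fun t : ℝ => 4 - 4 * t) (by fun_prop)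
    (mapsTo_sub_mul 4 (a := 3 / 4) (b := 1) (by norm_num) (by norm_num))).congr
    (concat_eqOn₄ (f₁ := f₁) (f₂ := f₂) h₃)
  have u₂ := c₁.union_of_isClosed c₂ isClosed_Icc isClosed_Icc
  rw [Set.Icc_union_Icc_eq_Icc (by norm_num) (by norm_num)] at u₂
  have u₃ := u₂.union_of_isClosed c₃ isClosed_Icc isClosed_Icc
  rw [Set.Icc_union_Icc_eq_Icc (by norm_num) (by norm_num)] at u₃
  have u₄ := u₃.union_of_isClosed c₄ isClosed_Icc isClosed_Icc
  rwa [Set.Icc_union_Icc_eq_Icc (by norm_num) (by norm_num)] at u₄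

end Concat

theorem piecewiseC1On_concat {f₁ f₂ f₃ f₄ : ℝ → ℂ} (h₁ : f₁ 1 = f₂ 0) (h₂ : f₂ 1 = f₃ 1)
    (h₃ : f₃ 0 = f₄ 1) (hf₁ : PiecewiseC1On f₁ 0 1) (hf₂ : PiecewiseC1On f₂ 0 1)
    (hf₃ : PiecewiseC1On f₃ 0 1) (hf₄ : PiecewiseC1On f₄ 0 1) :
    PiecewiseC1On (concat f₁ f₂ f₃ f₄) 0 1 := by
  have c₁ : PiecewiseC1On (concat f₁ f₂ f₃ f₄) 0 (1 / 4) :=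
    (PiecewiseC1On.comp_mul_add four_pos (by norm_num [hf₁])).congr concat_eqOn₁
  have c₂ : PiecewiseC1On (concat f₁ f₂ f₃ f₄) (1 / 4) (1 / 2) :=
    (PiecewiseC1On.comp_mul_add four_pos (by norm_num [hf₂])).congr (concat_eqOn₂ h₁)
  have c₃ : PiecewiseC1On (concat f₁ f₂ f₃ f₄) (1 / 2) (3 / 4) :=
    (PiecewiseC1On.comp_sub_mul four_pos (by norm_num [hf₃])).congr (concat_eqOn₃ h₂)
  have c₄ : PiecewiseC1On (concat f₁ f₂ f₃ f₄) (3 / 4) 1 :=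
    (PiecewiseC1On.comp_sub_mul four_pos (by norm_num [hf₄])).congr (concat_eqOn₄ h₃)
  exact ((c₁.trans c₂).trans c₃).trans c₄

theorem isSolutionOn_concat {n r : ℕ} {z : Fin r → ℂ} {A : Fin r → Matrix (Fin n) (Fin n) ℂ}
    {f₁ f₂ f₃ f₄ : ℝ → ℂ} {y₁ y₂ y₃ y₄ : ℝ → Fin n → ℂ}
    (h₁ : f₁ 1 = f₂ 0) (h₂ : f₂ 1 = f₃ 1) (h₃ : f₃ 0 = f₄ 1)
    (hy₁ : y₁ 1 = y₂ 0) (hy₂ : y₂ 1 = y₃ 1) (hy₃ : y₃ 0 = y₄ 1)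
    (hγ : ContinuousOn (concat f₁ f₂ f₃ f₄) (Set.Icc 0 1))
    (hz : ∀ t ∈ Set.Icc (0 : ℝ) 1, ∀ i, concat f₁ f₂ f₃ f₄ t ≠ z i)
    (hs₁ : IsSolutionOn z A f₁ y₁ 0 1) (hs₂ : IsSolutionOn z A f₂ y₂ 0 1)
    (hs₃ : IsSolutionOn z A f₃ y₃ 0 1) (hs₄ : IsSolutionOn z A f₄ y₄ 0 1) :
    IsSolutionOn z A (concat f₁ f₂ f₃ f₄) (concat y₁ y₂ y₃ y₄) 0 1 := by
  have c₁ : IsSolutionOn z A (concat f₁ f₂ f₃ f₄) (concat y₁ y₂ y₃ y₄) 0 (1 / 4) :=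
    (hs₁.comp (by fun_prop) (mapsTo_mul_add 0 (by norm_num) (by norm_num))).congr
      concat_eqOn₁ concat_eqOn₁
  have c₂ : IsSolutionOn z A (concat f₁ f₂ f₃ f₄) (concat y₁ y₂ y₃ y₄) (1 / 4) (1 / 2) :=
    (hs₂.comp (by fun_prop) (mapsTo_mul_add (-1) (by norm_num) (by norm_num))).congr
      (concat_eqOn₂ h₁) (concat_eqOn₂ hy₁)
  have c₃ : IsSolutionOn z A (concat f₁ f₂ f₃ f₄) (concat y₁ y₂ y₃ y₄) (1 / 2) (3 / 4) :=
    (hs₃.comp (by fun_prop) (mapsTo_sub_mul 3 (by norm_num) (by norm_num))).congr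
      (concat_eqOn₃ h₂) (concat_eqOn₃ hy₂)
  have c₄ : IsSolutionOn z A (concat f₁ f₂ f₃ f₄) (concat y₁ y₂ y₃ y₄) (3 / 4) 1 :=
    (hs₄.comp (by fun_prop) (mapsTo_sub_mul 4 (by norm_num) (by norm_num))).congr
      (concat_eqOn₄ h₃) (concat_eqOn₄ hy₃)
  have u₂ := c₁.trans c₂ (by norm_num) (by norm_num)
    (hγ.mono (Set.Icc_subset_Icc_right (by norm_num))) (hz _ ⟨by norm_num, by norm_num⟩)
  have u₃ := u₂.trans c₃ (by norm_num) (by norm_num)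
    (hγ.mono (Set.Icc_subset_Icc_right (by norm_num))) (hz _ ⟨by norm_num, by norm_num⟩)
  exact u₃.trans c₄ (by norm_num) (by norm_num) hγ (hz _ ⟨by norm_num, by norm_num⟩)

/-- Continuous logarithms exist along paths in `ℂ ∖ {0}`. -/
theorem exists_log_along {f : ℝ → ℂ} (hf : ContinuousOn f (Set.Icc 0 1))
    (h0 : ∀ t ∈ Set.Icc (0 : ℝ) 1, f t ≠ 0) {c : ℂ} (hc : Complex.exp c = f 0) :
    ∃ ℓ : ℝ → ℂ, ContinuousOn ℓ (Set.Icc 0 1) ∧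
      (∀ t ∈ Set.Icc (0 : ℝ) 1, Complex.exp (ℓ t) = f t) ∧ ℓ 0 = c := by
  let g : C(unitInterval, {z : ℂ // z ≠ 0}) :=
    ⟨fun t => ⟨f t, h0 t t.2⟩, (continuousOn_iff_continuous_domRestrict.mp hf).subtype_mk _⟩
  obtain ⟨Γ, hΓ, hΓ0⟩ := Complex.isCoveringMap_exp.exists_path_lifts g c
    (Subtype.ext hc.symm)
  refine ⟨Set.IccExtend zero_le_one Γ, (Γ.continuous.Icc_extend').continuousOn, fun t ht => ?_, ?_⟩
  · rw [Set.IccExtend_of_mem _ _ ht]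
    exact congrArg Subtype.val (congrFun hΓ ⟨t, ht⟩)
  · rw [Set.IccExtend_left]
    exact hΓ0

/-- A branch of `log (ζ₀ - s)` along a path extends to branches of `log (ζ - s)` for all `ζ` in a
disc around `ζ₀` which does not meet the path. -/
theorem log_branch_extend {γ ℓ : ℝ → ℂ} {ζ₀ : ℂ} {ε : ℝ}
    (hγ : ContinuousOn γ (Set.Icc 0 1)) (hℓ : ContinuousOn ℓ (Set.Icc 0 1))
    (hexp : ∀ t ∈ Set.Icc (0 : ℝ) 1, Complex.exp (ℓ t) = ζ₀ - γ t)
    (hε : ∀ t ∈ Set.Icc (0 : ℝ) 1, γ t ∉ Metric.ball ζ₀ ε) :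
    ContinuousOn (fun q : ℂ × ℝ => ℓ q.2 + Complex.log (1 + (q.1 - ζ₀) / (ζ₀ - γ q.2)))
        (Metric.ball ζ₀ ε ×ˢ Set.Icc (0 : ℝ) 1) ∧
      ∀ ζ ∈ Metric.ball ζ₀ ε, ∀ t ∈ Set.Icc (0 : ℝ) 1,
        Complex.exp (ℓ t + Complex.log (1 + (ζ - ζ₀) / (ζ₀ - γ t))) = ζ - γ t := by
  have h0 : ∀ t ∈ Set.Icc (0 : ℝ) 1, ζ₀ - γ t ≠ 0 := fun t ht =>
    hexp t ht ▸ Complex.exp_ne_zero _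
  have hslit : ∀ ζ ∈ Metric.ball ζ₀ ε, ∀ t ∈ Set.Icc (0 : ℝ) 1,
      1 + (ζ - ζ₀) / (ζ₀ - γ t) ∈ Complex.slitPlane := by
    intro ζ hζ t ht
    refine Complex.mem_slitPlane_of_norm_lt_one ?_
    rw [norm_div, div_lt_one (norm_pos_iff.mpr (h0 t ht)), ← dist_eq_norm, ← dist_eq_norm]
    have := hε t ht
    rw [Metric.mem_ball, not_lt, dist_comm] at this
    exact (Metric.mem_ball.mp hζ).trans_le this
  constructor
  · have hsnd : ∀ {k : ℝ → ℂ}, ContinuousOn k (Set.Icc 0 1) → ContinuousOn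
        (fun q : ℂ × ℝ => k q.2) (Metric.ball ζ₀ ε ×ˢ Set.Icc (0 : ℝ) 1) := fun hk =>
      hk.comp continuousOn_snd fun q hq => hq.2
    refine (hsnd hℓ).add (ContinuousOn.clog (continuousOn_const.add (ContinuousOn.div
      (continuousOn_fst.sub continuousOn_const) (continuousOn_const.sub (hsnd hγ))
      fun q hq => h0 q.2 hq.2)) fun q hq => hslit q.1 hq.1 q.2 hq.2)
  · intro ζ hζ t ht
    rw [Complex.exp_add, hexp t ht, Complex.exp_log (Complex.slitPlane_ne_zero (hslit ζ hζ t ht)),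
      mul_add, mul_one, mul_div_cancel₀ _ (h0 t ht)]
    ring

/-- The solution returns to its initial value along `β`, and the logarithm along `α`; so both
return along the commutator of `α` and `β`. -/
theorem exists_isTwistedCycle_pochhammer {n r : ℕ} {z : Fin r → ℂ}
    (A : Fin r → Matrix (Fin n) (Fin n) ℂ) (lam : ℂ) {ζ₀ c : ℂ} {ρ : ℝ} {α β h : ℝ → ℂ}
    (hα : PiecewiseC1 α) (hβ : PiecewiseC1 β) (hα1 : α 0 = α 1) (hβ1 : β 0 = β 1)
    (hαβ : α 0 = β 0) (hζ₀ : ∀ i, ζ₀ ≠ z i) (hzc : ∀ i, z i ∉ Metric.ball c ρ)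
    (hαz : ∀ t ∈ Set.Icc (0 : ℝ) 1, ∀ i, α t ≠ z i)
    (hβc : ∀ t ∈ Set.Icc (0 : ℝ) 1, β t ∈ Metric.ball c ρ ∧ β t ≠ ζ₀)
    (hh : ContinuousOn h (Set.Icc (0 : ℝ) 1))
    (hexp : ∀ t ∈ Set.Icc (0 : ℝ) 1, Complex.exp (h t) = ζ₀ - α t) (hh1 : h 0 = h 1)
    (v : Fin n → ℂ) :
    ∃ ε > (0 : ℝ), ∃ (y : ℝ → Fin n → ℂ) (L : ℂ → ℝ → ℂ),
      IsTwistedCycle z A lam (Metric.ball ζ₀ ε) (pochhammer α β) y L ∧ y 0 = v := by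
  have hαcont : ContinuousOn α (Set.Icc 0 1) := PiecewiseC1On.continuousOn hα
  have hβcont : ContinuousOn β (Set.Icc 0 1) := PiecewiseC1On.continuousOn hβ
  have h0mem : (0 : ℝ) ∈ Set.Icc (0 : ℝ) 1 := ⟨le_rfl, zero_le_one⟩
  have hc₁ : α 1 = β 0 := hα1.symm.trans hαβ
  have hc₂ : β 1 = α 1 := hβ1.symm.trans (hαβ.symm.trans hα1)
  have hc₃ : α 0 = β 1 := hαβ.trans hβ1
  set γ : ℝ → ℂ := concat α β α β with hγdef
  have hγcont : ContinuousOn γ (Set.Icc 0 1) :=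
    continuousOn_concat hc₁ hc₂ hc₃ hαcont hβcont hαcont hβcont
  have hγz : ∀ t ∈ Set.Icc (0 : ℝ) 1, ∀ i, γ t ≠ z i := by
    have hβz : ∀ t ∈ Set.Icc (0 : ℝ) 1, ∀ i, β t ≠ z i := fun t ht i hi =>
      hzc i (hi ▸ (hβc t ht).1)
    exact fun t ht => concat_forall₂ (R := fun x (_ : ℂ) => ∀ i, x ≠ z i)
      (g₁ := α) (g₂ := α) (g₃ := α) (g₄ := α) hαz hβz hαz hβz ht
  -- `β` stays in a smaller disc, on which the coefficients of the system are bounded.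
  obtain ⟨ρ', hρ', hβρ'⟩ : ∃ ρ' < ρ, ∀ t ∈ Set.Icc (0 : ℝ) 1, β t ∈ Metric.ball c ρ' := by
    have hdist : ContinuousOn (fun t => dist (β t) c) (Set.Icc 0 1) :=
      (continuous_id.dist continuous_const).comp_continuousOn hβcont
    obtain ⟨t₀, ht₀, hmax⟩ := isCompact_Icc.exists_isMaxOn ⟨0, h0mem⟩ hdist
    have hlt := Metric.mem_ball.mp (hβc t₀ ht₀).1
    refine ⟨(dist (β t₀) c + ρ) / 2, by linarith, fun t ht => ?_⟩
    have hle : dist (β t) c ≤ dist (β t₀) c := hmax ht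
    rw [Metric.mem_ball]
    linarith
  obtain ⟨y₁, hy₁, hy₁0⟩ := exists_isSolutionOn (A := A) hαcont hαz v
  obtain ⟨F, hF0, hF⟩ := exists_solvesAt_ball (A := A) hρ' hzc (hβρ' 0 h0mem) (y₁ 1)
  obtain ⟨G, hG0, hG⟩ := exists_solvesAt_ball (A := A) hρ' hzc (hβρ' 0 h0mem) v
  have hy := isSolutionOn_concat hc₁ hc₂ hc₃ (y₂ := fun t => F (β t)) (y₄ := fun t => G (β t))
    hF0.symm (by simp only [← hβ1, hF0]) (by simp only [← hβ1, hG0, hy₁0]) hγcont hγz hy₁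
    (isSolutionOn_comp Metric.isOpen_ball hF hβρ') hy₁
    (isSolutionOn_comp Metric.isOpen_ball hG hβρ')
  obtain ⟨ℓ, hℓ, hℓexp, hℓ0⟩ := exists_log_along (f := fun t => ζ₀ - β t) (c := h 0)
    (continuousOn_const.sub hβcont) (fun t ht => sub_ne_zero.mpr (hβc t ht).2.symm)
    (by rw [hexp 0 h0mem, hαβ])
  -- On the way back along `α`, the logarithm has the period picked up along `β`.
  have hperiod : Complex.exp (ℓ 1 - h 0) = 1 := by
    rw [Complex.exp_sub, hℓexp 1 ⟨zero_le_one, le_rfl⟩, hexp 0 h0mem, hαβ, hβ1,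
      div_self (sub_ne_zero.mpr (hβc 1 ⟨zero_le_one, le_rfl⟩).2.symm)]
  set ℓγ : ℝ → ℂ := concat h ℓ (fun t => h t + (ℓ 1 - h 0)) ℓ with hℓγdef
  have hℓγ : ContinuousOn ℓγ (Set.Icc 0 1) :=
    continuousOn_concat (by rw [hℓ0, hh1]) (by simp [← hh1]) (by simp) hh hℓ
      (hh.add continuousOn_const) hℓ
  have hℓγexp : ∀ t ∈ Set.Icc (0 : ℝ) 1, Complex.exp (ℓγ t) = ζ₀ - γ t := fun t ht =>
    concat_forall₂ (R := fun x y => Complex.exp x = ζ₀ - y) hexp hℓexp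
      (fun t ht => by rw [Complex.exp_add, hperiod, mul_one, hexp t ht]) hℓexp ht
  obtain ⟨ε, hε, hball⟩ : ∃ ε > 0, Metric.ball ζ₀ ε ⊆ (γ '' Set.Icc 0 1 ∪ Set.range z)ᶜ := by
    refine Metric.isOpen_iff.mp (((isCompact_Icc.image_of_continuousOn hγcont).isClosed.union
      (Set.finite_range z).isClosed).isOpen_compl) ζ₀ ?_
    rintro (⟨t, ht, htζ⟩ | ⟨i, hi⟩)
    · have := hℓγexp t ht
      rw [htζ, sub_self] at this
      exact Complex.exp_ne_zero _ this
    · exact hζ₀ i hi.symm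
  obtain ⟨hLcont, hLexp⟩ := log_branch_extend hγcont hℓγ hℓγexp (ε := ε)
    fun t ht hmem => hball hmem (Or.inl ⟨t, ht, rfl⟩)
  have hclosed : γ 0 = γ 1 := by rw [hγdef, concat_zero, concat_one, hαβ]
  refine ⟨ε, hε, _, _, ⟨Metric.isOpen_ball, fun i hi => hball hi (Or.inr ⟨i, rfl⟩),
    piecewiseC1On_concat hc₁ hc₂ hc₃ hα hβ hα hβ, hclosed, hγz, hy, hLcont, hLexp,
    fun ζ _ => ?_⟩, ?_⟩
  · rw [← hclosed, hℓγdef, concat_zero, concat_one, concat_zero, concat_one, hℓ0, hG0, hy₁0]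
  · rw [concat_zero, hy₁0]

end Fuchs

end

open Fuchs in
theorem mainTheorem1 {n r : ℕ} (z : Fin r → ℂ) (hz : Function.Injective z)
    (A : Fin r → Matrix (Fin n) (Fin n) ℂ)
    (m : Option (Fin r) → ℕ) (w : ∀ b, Fin (m b + 2) → ℂ)
    (hP : ∀ b, Polynomial.aeval (resMat A b)
      (∏ l, (Polynomial.X - Polynomial.C (w b l))) = 0)
    (hnorm : ∀ i, w (some i) 0 = 0)
    (lam : ℂ) (hlam : lam = ∑ b, w b 0) (hlam0 : lam ≠ 0) :
    -- the system is described by a module of the deformed preprojective algebra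
    Describes (definingGauge A w) A w ∧
    -- the middle convolution exists
    (∃ (n' : ℕ) (P : Matrix (Fin n') (Fin r × Fin n) ℂ) (A' : Fin r → Matrix (Fin n') (Fin n') ℂ),
      IsMiddleConvolution A lam P A') ∧
    (∀ (n' : ℕ) (P : Matrix (Fin n') (Fin r × Fin n) ℂ) (A' : Fin r → Matrix (Fin n') (Fin n') ℂ),
      IsMiddleConvolution A lam P A' →
      -- its order
      n' + n = ∑ b, Module.finrank ℂ (filt (resMat A b) (w b) 1) ∧
      -- it is the system described by the reflected module
      (∀ X : StarRep (Option (Fin r)) m, Describes X A w →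
        (X.reflect lam).IsModule (couplingsOf w).reflect ∧
        ∃ f : (Fin n' → ℂ) ≃ₗ[ℂ] (X.reflect lam).center,
          ∀ b v, f (resMat A' b *ᵥ v) = (X.reflect lam).residue (normExp (-lam)) b (f v)) ∧
      -- its solutions by integrals over twisted cycles
      (∀ (D : Set ℂ) (γ : ℝ → ℂ) (y : ℝ → Fin n → ℂ) (L : ℂ → ℝ → ℂ),
        IsTwistedCycle z A lam D γ y L →
        ∀ ζ ∈ D, SolvesAt z A' (riemannLiouville z P lam γ y L) ζ)) ∧
    -- Pochhammer contours are twisted cycles, for every solution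
    (∀ (ζ₀ c : ℂ) (ρ : ℝ) (α β h : ℝ → ℂ),
      PiecewiseC1 α → PiecewiseC1 β →
      α 0 = α 1 → β 0 = β 1 → α 0 = β 0 →
      (∀ i, ζ₀ ≠ z i) → (∀ i, z i ∉ Metric.ball c ρ) →
      (∀ t ∈ Set.Icc (0 : ℝ) 1, ∀ i, α t ≠ z i) →
      (∀ t ∈ Set.Icc (0 : ℝ) 1, β t ∈ Metric.ball c ρ ∧ β t ≠ ζ₀) →
      ContinuousOn h (Set.Icc (0 : ℝ) 1) →
      (∀ t ∈ Set.Icc (0 : ℝ) 1, Complex.exp (h t) = ζ₀ - α t) → h 0 = h 1 →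
      ∀ v : Fin n → ℂ, ∃ ε > (0 : ℝ), ∃ (y : ℝ → Fin n → ℂ) (L : ℂ → ℝ → ℂ),
        IsTwistedCycle z A lam (Metric.ball ζ₀ ε) (pochhammer α β) y L ∧ y 0 = v) := by
  have hlam' : (couplingsOf w).center = lam := hlam.symm
  refine ⟨definingGauge_describes A w hP, exists_isMiddleConvolution A lam, fun n' P A' hPA => ?_,
    fun ζ₀ c ρ α β h hα hβ hα1 hβ1 hαβ hζ₀ hzc hαz hβc hh hexp hh1 v =>
      exists_isTwistedCycle_pochhammer A lam hα hβ hα1 hβ1 hαβ hζ₀ hzc hαz hβc hh hexp hh1 v⟩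
  subst hlam'
  exact ⟨hPA.order_add hP hnorm hlam0,
    fun X hX => ⟨hX.isModule.reflect hlam0, hPA.exists_equiv_reflect hX hnorm hlam0⟩,
    fun D γ y L hcycle ζ hζ => hcycle.solvesAt_riemannLiouville hζ hPA⟩
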